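/- **Setting.** Let $\mathfrak h$ be a complex Hilbert space, $L_1,\dots,L_n\in\mathfrak B(\mathfrak h)$, $H=H^*\in\mathfrak B(\mathfrak h)$, $A\subseteq\{1,\dots,n\}$ (the measured channels) and $\theta_\alpha\in\mathbb R$ for $\alpha\in A$. Write $\zeta_B(X)=XB+B^*X$, $[X,H]=XH-HX$ and $$\mathcal L_GX=\sum_{k=1}^n\Big\{L_k^*XL_k-\tfrac12L_k^*L_kX-\tfrac12XL_k^*L_k\Big\}-i[X,H],\qquad \tilde{\mathcal L}_{G,\Theta}=\mathcal L_G-\tfrac12\sum_{\alpha\in A}\zeta_{e^{i\theta_\alpha}L_\alpha}\circ\zeta_{e^{i\theta_\alpha}L_\alpha}.$$ On a probability space with a filtration, let $Y_\alpha$ ($\alpha\in A$) be real processes with $dY_\alpha=dW_\alpha+h_\alpha\,dt$, $Y_\alpha(0)=0$, where the $W_\alpha$ are independent standard Brownian motions relative to the filtration and the $h_\alpha$ are arbitrary progressively measurable processes that are almost surely locally integrable in time. (The record of the measured output quadratures is of this form, both under the physical law and under the reference law, where $h_\alpha=0$.) Let $\rho_0$ be a density operator and let $\sigma_t$, $t\ge0$,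 be random linear functionals on $\mathfrak B(\mathfrak h)$ such that, for each $X\in\mathfrak B(\mathfrak h)$, the process $\sigma_t(X)$ is adapted with almost surely continuous paths and $\sigma_0(X)=\mathrm{tr}\{\rho_0X\}$ almost surely. For a continuous adapted complex process $Z$, the Itô integral $\int_0^t Z\,dY_\alpha$ is the continuous process that is, at each $t$, the limit in probability of the left-point sums over deterministic partitions of $[0,t]$ with mesh tending to $0$. The bracket, with $d[Z,Y_\alpha]=dZ\,dY_\alpha$, is the continuous process of locally bounded variation that is, at each $t$, the limit in probability of the sums of products of increments over such partitions. The Stratonovich integral is given by $Z\circ dY_\alpha=Z\,dY_\alpha+\tfrac12\,dZ\,dY_\alpha$; that an equation holds includes that the integrals and brackets in it exist. **Proposition (Stratonovich form of the Belavkin–Zakai equation).** (1) The process $\sigma$ satisfies the Belavkin–Zakai equation $$d\sigma_t(X)=\sigma_t(\mathcal L_GX)\,dt+\sum_{\alpha\in A}\sigma_t\big(XL_\alpha e^{i\theta_\alpha}+e^{-i\theta_\alpha}L_\alpha^*X\big)\,dY_\alpha(t)\qquad\text{for all }X\in\mathfrak B(\mathfrak h)$$ in the Itô sense if and only if it satisfies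 the Stratonovich equation $$d\sigma_t(X)=\sigma_t\big(\tilde{\mathcal L}_{G,\Theta}X\big)\,dt+\sum_{\alpha\in A}\sigma_t\big(\zeta_{e^{i\theta_\alpha}L_\alpha}X\big)\circ dY_\alpha(t)\qquad\text{for all }X\in\mathfrak B(\mathfrak h).$$ (2) Moreover $\tilde{\mathcal L}_{G,\Theta}=\zeta_{K(G,\Theta)}+\mathcal L_{\rm unobs}$, where $$K(G,\Theta)=-\tfrac12\sum_{\alpha\in A}\big(L_\alpha^*L_\alpha+e^{2i\theta_\alpha}L_\alpha^2\big)-iH,\qquad \mathcal L_{\rm unobs}X=\sum_{k\notin A}\Big\{L_k^*XL_k-\tfrac12L_k^*L_kX-\tfrac12XL_k^*L_k\Big\}.$$ -/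

import Mathlib

open MeasureTheory ProbabilityTheory Filter Topology
open scoped NNReal ENNReal InnerProductSpace

noncomputable section

namespace BelavkinZakai

/-! ### Super-operators on the bounded operators of a Hilbert space -/

section Superoperators

variable {𝔥 : Type*} [NormedAddCommGroup 𝔥] [InnerProductSpace ℂ 𝔥] [CompleteSpace 𝔥]

/-- The super-operator `ζ_B(X) = X B + B* X`. -/
def zeta (B : 𝔥 →L[ℂ] 𝔥) : (𝔥 →L[ℂ] 𝔥) →ₗ[ℂ] (𝔥 →L[ℂ] 𝔥) where
  toFun X := X * B + star B * X
  map_add' X Y := by rw [add_mul, mul_add]; abel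
  map_smul' c X := by simp [smul_add]

/-- The dissipator of one noise channel:
`X ↦ L* X L - ½ L* L X - ½ X L* L`. -/
def dissipator (L : 𝔥 →L[ℂ] 𝔥) : (𝔥 →L[ℂ] 𝔥) →ₗ[ℂ] (𝔥 →L[ℂ] 𝔥) where
  toFun X := star L * X * L - (1 / 2 : ℂ) • (star L * L * X) - (1 / 2 : ℂ) • (X * (star L * L))
  map_add' X Y := by simp only [mul_add, add_mul, smul_add]; abel
  map_smul' c X := by simp [smul_sub, smul_comm c (2⁻¹ : ℂ)]

/-- The derivation `X ↦ -i [X, H]`. -/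
def hamiltonianPart (H : 𝔥 →L[ℂ] 𝔥) : (𝔥 →L[ℂ] 𝔥) →ₗ[ℂ] (𝔥 →L[ℂ] 𝔥) where
  toFun X := -(Complex.I • (X * H - H * X))
  map_add' X Y := by simp only [mul_add, add_mul, smul_add, smul_sub]; abel
  map_smul' c X := by simp [← smul_sub, smul_comm c Complex.I]

variable {n : ℕ}

/-- The Lindbladian `𝓛_G` of the model `G = (L, H)` with `n` channels. -/
def lindbladian (L : Fin n → 𝔥 →L[ℂ] 𝔥) (H : 𝔥 →L[ℂ] 𝔥) :
    (𝔥 →L[ℂ] 𝔥) →ₗ[ℂ] (𝔥 →L[ℂ] 𝔥) :=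
  (∑ k, dissipator (L k)) + hamiltonianPart H

/-- The Lindbladian of the channels that are not measured. -/
def unobservedLindbladian (L : Fin n → 𝔥 →L[ℂ] 𝔥) (A : Finset (Fin n)) :
    (𝔥 →L[ℂ] 𝔥) →ₗ[ℂ] (𝔥 →L[ℂ] 𝔥) :=
  ∑ k ∈ Aᶜ, dissipator (L k)

/-- The operator `e^{iθ_α} L_α` of a measured channel `α ∈ A`. -/
def rotated (L : Fin n → 𝔥 →L[ℂ] 𝔥) {A : Finset (Fin n)} (θ : A → ℝ) (α : A) : 𝔥 →L[ℂ] 𝔥 :=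
  Complex.exp (Complex.I * θ α) • L α

/-- `𝓛̃_{G,Θ} = 𝓛_G - ½ ∑_{α ∈ A} ζ_{e^{iθ_α} L_α} ∘ ζ_{e^{iθ_α} L_α}`. -/
def stratonovichGenerator (L : Fin n → 𝔥 →L[ℂ] 𝔥) (H : 𝔥 →L[ℂ] 𝔥) {A : Finset (Fin n)}
    (θ : A → ℝ) : (𝔥 →L[ℂ] 𝔥) →ₗ[ℂ] (𝔥 →L[ℂ] 𝔥) :=
  lindbladian L H - (1 / 2 : ℂ) • ∑ α, zeta (rotated L θ α) ∘ₗ zeta (rotated L θ α)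

/-- `K(G,Θ) = -½ ∑_{α ∈ A} (L_α* L_α + e^{2iθ_α} L_α²) - i H`. -/
def coherentOperator (L : Fin n → 𝔥 →L[ℂ] 𝔥) (H : 𝔥 →L[ℂ] 𝔥) {A : Finset (Fin n)}
    (θ : A → ℝ) : 𝔥 →L[ℂ] 𝔥 :=
  -((1 / 2 : ℂ) • ∑ α : A,
      (star (L α) * L α + Complex.exp (2 * Complex.I * θ α) • (L α * L α))) - Complex.I • H

/-- The diagonal matrix elements of `T` in a fixed Hilbert basis of `𝔥`. -/
def diagonalEntry (T : 𝔥 →L[ℂ] 𝔥) (i : (exists_hilbertBasis ℂ 𝔥).choose) : ℂ :=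
  ⟪(exists_hilbertBasis ℂ 𝔥).choose_spec.choose i,
    T ((exists_hilbertBasis ℂ 𝔥).choose_spec.choose i)⟫_ℂ

/-- The trace `tr T = ∑ᵢ ⟨eᵢ, T eᵢ⟩`; it is used for trace-class operators only, for which the sum
converges absolutely and does not depend on the basis. -/
def opTrace (T : 𝔥 →L[ℂ] 𝔥) : ℂ := ∑' i, diagonalEntry T i

/-- A density operator: positive, of trace class, with trace one. -/
def IsDensityOperator (ρ : 𝔥 →L[ℂ] 𝔥) : Prop :=
  ρ.IsPositive ∧ HasSum (diagonalEntry ρ) 1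

end Superoperators

/-! ### Itô and Stratonovich integrals of continuous processes

The integrals and the bracket are the limits in probability of the usual sums over deterministic
partitions whose mesh tends to zero. -/

section Integrals

/-- A finite partition `0 = t₀ ≤ t₁ ≤ ⋯ ≤ t_N = t` of `[0, t]`. -/
structure Partition (t : ℝ≥0) where
  size : ℕ
  pt : ℕ → ℝ≥0
  mono : Monotone pt
  pt_zero : pt 0 = 0
  pt_size : pt size = t

/-- The largest step of a partition. -/
def Partition.mesh {t : ℝ≥0} (π : Partition t) : ℝ≥0 :=
  (Finset.range π.size).sup fun i => π.pt (i + 1) - π.pt i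

variable {Ω : Type*} [MeasurableSpace Ω]

/-- `J_t = ∫₀ᵗ Z dY` in the sense of Itô, for a continuous complex integrand `Z` and a continuous
real integrator `Y`: `J` is continuous, and `J_t` is the limit in probability of the left-point
sums `∑ᵢ Z_{tᵢ} (Y_{tᵢ₊₁} - Y_{tᵢ})`. -/
structure IsItoIntegral (P : Measure Ω) (Z : ℝ≥0 → Ω → ℂ) (Y : ℝ≥0 → Ω → ℝ)
    (J : ℝ≥0 → Ω → ℂ) : Prop where
  continuous : ∀ᵐ ω ∂P, Continuous fun t => J t ω
  tendsto : ∀ (t : ℝ≥0) (π : ℕ → Partition t), Tendsto (fun m => (π m).mesh) atTop (𝓝 0) →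
    TendstoInMeasure P
      (fun m ω => ∑ i ∈ Finset.range (π m).size, Z ((π m).pt i) ω *
        ((Y ((π m).pt (i + 1)) ω - Y ((π m).pt i) ω : ℝ) : ℂ))
      atTop (J t)

/-- `C = [Z, Y]`, i.e. `dC = dZ dY`: `C` is continuous with paths of locally bounded variation, and
`C_t` is the limit in probability of `∑ᵢ (Z_{tᵢ₊₁} - Z_{tᵢ}) (Y_{tᵢ₊₁} - Y_{tᵢ})`. -/
structure IsCovariation (P : Measure Ω) (Z : ℝ≥0 → Ω → ℂ) (Y : ℝ≥0 → Ω → ℝ)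
    (C : ℝ≥0 → Ω → ℂ) : Prop where
  continuous : ∀ᵐ ω ∂P, Continuous fun t => C t ω
  boundedVariation : ∀ᵐ ω ∂P, LocallyBoundedVariationOn (fun t => C t ω) Set.univ
  tendsto : ∀ (t : ℝ≥0) (π : ℕ → Partition t), Tendsto (fun m => (π m).mesh) atTop (𝓝 0) →
    TendstoInMeasure P
      (fun m ω => ∑ i ∈ Finset.range (π m).size,
        (Z ((π m).pt (i + 1)) ω - Z ((π m).pt i) ω) *
        ((Y ((π m).pt (i + 1)) ω - Y ((π m).pt i) ω : ℝ) : ℂ))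
      atTop (C t)

/-- `S_t = ∫₀ᵗ Z ∘ dY` in the sense of Stratonovich: `Z ∘ dY = Z dY + ½ dZ dY`. -/
def IsStratonovichIntegral (P : Measure Ω) (Z : ℝ≥0 → Ω → ℂ) (Y : ℝ≥0 → Ω → ℝ)
    (S : ℝ≥0 → Ω → ℂ) : Prop :=
  ∃ J C : ℝ≥0 → Ω → ℂ, IsItoIntegral P Z Y J ∧ IsCovariation P Z Y C ∧
    ∀ t ω, S t ω = J t ω + (1 / 2 : ℂ) * C t ω

end Integrals

/-! ### The observed quadratures and the two equations -/

section Equations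

variable {Ω : Type*} [mΩ : MeasurableSpace Ω]

/-- A family of independent standard Brownian motions relative to a filtration. -/
structure IsBrownianFamily {ι : Type*} (P : Measure Ω) (𝓕 : Filtration ℝ≥0 mΩ)
    (W : ι → ℝ≥0 → Ω → ℝ) : Prop where
  brownian : ∀ α, IsBrownianReal (W α) P
  independent : iIndepFun (fun α ω t => W α t ω) P
  adapted : ∀ α, StronglyAdapted 𝓕 (W α)
  increments : ∀ s t : ℝ≥0, s ≤ t →
    Indep (MeasurableSpace.comap (fun ω α => W α t ω - W α s ω) inferInstance) (𝓕 s) P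

/-- The record of the measured output quadratures: `dY_α = dW_α + h_α dt`, `Y_α(0) = 0`, with
independent Brownian motions `W_α` and an arbitrary progressively measurable, locally integrable
signal `h_α`. The commuting output quadratures are of this form both under the physical law
(with `h_α` the conditional mean of `e^{iθ_α} L_α + e^{-iθ_α} L_α*`) and under the reference law
(with `h_α = 0`). -/
def IsObservationRecord {ι : Type*} (P : Measure Ω) (𝓕 : Filtration ℝ≥0 mΩ)
    (Y : ι → ℝ≥0 → Ω → ℝ) : Prop :=
  ∃ W h : ι → ℝ≥0 → Ω → ℝ, IsBrownianFamily P 𝓕 W ∧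
    (∀ α, IsStronglyProgressive 𝓕 (h α)) ∧
    (∀ α, ∀ᵐ ω ∂P, ∀ t : ℝ≥0,
      IntervalIntegrable (fun s : ℝ => h α s.toNNReal ω) volume 0 t) ∧
    ∀ α, ∀ᵐ ω ∂P, ∀ t : ℝ≥0, Y α t ω = W α t ω + ∫ s in (0 : ℝ)..t, h α s.toNNReal ω

variable {𝔥 : Type*} [NormedAddCommGroup 𝔥] [InnerProductSpace ℂ 𝔥] [CompleteSpace 𝔥]

/-- A random flow `σ_t` of linear functionals on the bounded operators, adapted and continuous in
time on each operator, and with `σ_0(X) = tr(ρ₀ X)`. -/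
structure IsFunctionalProcess (P : Measure Ω) (𝓕 : Filtration ℝ≥0 mΩ) (ρ₀ : 𝔥 →L[ℂ] 𝔥)
    (σ : ℝ≥0 → Ω → (𝔥 →L[ℂ] 𝔥) →ₗ[ℂ] ℂ) : Prop where
  adapted : ∀ X, StronglyAdapted 𝓕 fun t ω => σ t ω X
  continuous : ∀ X, ∀ᵐ ω ∂P, Continuous fun t => σ t ω X
  initial : ∀ X, ∀ᵐ ω ∂P, σ 0 ω X = opTrace (ρ₀ * X)

variable {n : ℕ}

/-- `σ` solves the Belavkin-Zakai equation, in Itô form, with initial state `ρ₀`: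
`dσ_t(X) = σ_t(𝓛_G X) dt + ∑_α σ_t(X L_α e^{iθ_α} + e^{-iθ_α} L_α* X) dY_α` for every `X`. -/
structure SolvesIto (P : Measure Ω) (𝓕 : Filtration ℝ≥0 mΩ) (L : Fin n → 𝔥 →L[ℂ] 𝔥)
    (H : 𝔥 →L[ℂ] 𝔥) {A : Finset (Fin n)} (θ : A → ℝ) (Y : A → ℝ≥0 → Ω → ℝ)
    (ρ₀ : 𝔥 →L[ℂ] 𝔥) (σ : ℝ≥0 → Ω → (𝔥 →L[ℂ] 𝔥) →ₗ[ℂ] ℂ) : Prop where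
  process : IsFunctionalProcess P 𝓕 ρ₀ σ
  equation : ∀ X : 𝔥 →L[ℂ] 𝔥, ∃ J : A → ℝ≥0 → Ω → ℂ,
    (∀ α : A, IsItoIntegral P
      (fun t ω => σ t ω (Complex.exp (Complex.I * θ α) • (X * L α) +
        Complex.exp (-(Complex.I * θ α)) • (star (L α) * X))) (Y α) (J α)) ∧
    ∀ᵐ ω ∂P, ∀ t : ℝ≥0, σ t ω X = σ 0 ω X +
      (∫ s in (0 : ℝ)..t, σ s.toNNReal ω (lindbladian L H X)) + ∑ α, J α t ω

/-- `σ` solves, with initial state `ρ₀`, the Stratonovich equation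
`dσ_t(X) = σ_t(𝓛̃_{G,Θ} X) dt + ∑_α σ_t(ζ_{e^{iθ_α} L_α} X) ∘ dY_α` for every `X`. -/
structure SolvesStratonovich (P : Measure Ω) (𝓕 : Filtration ℝ≥0 mΩ) (L : Fin n → 𝔥 →L[ℂ] 𝔥)
    (H : 𝔥 →L[ℂ] 𝔥) {A : Finset (Fin n)} (θ : A → ℝ) (Y : A → ℝ≥0 → Ω → ℝ)
    (ρ₀ : 𝔥 →L[ℂ] 𝔥) (σ : ℝ≥0 → Ω → (𝔥 →L[ℂ] 𝔥) →ₗ[ℂ] ℂ) : Prop where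
  process : IsFunctionalProcess P 𝓕 ρ₀ σ
  equation : ∀ X : 𝔥 →L[ℂ] 𝔥, ∃ S : A → ℝ≥0 → Ω → ℂ,
    (∀ α : A, IsStratonovichIntegral P
      (fun t ω => σ t ω (zeta (rotated L θ α) X)) (Y α) (S α)) ∧
    ∀ᵐ ω ∂P, ∀ t : ℝ≥0, σ t ω X = σ 0 ω X +
      (∫ s in (0 : ℝ)..t, σ s.toNNReal ω (stratonovichGenerator L H θ X)) + ∑ α, S α t ω

end Equations

end BelavkinZakai

end

noncomputable section

namespace BelavkinZakai

/-! ### Calculus of limits in probability. -/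

section ConvergenceInMeasure

variable {Ω ι E : Type*} [MeasurableSpace Ω] {μ : Measure Ω} [NormedAddCommGroup E] {l : Filter ι}

/-! The Itô equation expresses `σ(X)` as its initial value, a drift and integrals of `σ(ζ_β X)`
against `Y_β`. Since `dY_β dY_α = δ_{αβ} dt`, its bracket with `Y_α` is `∫ σ(ζ_α X) dt`. The
equation holds for every operator, so it may be read at `ζ_α X`: the Stratonovich correction of the
integrand `σ(ζ_α X)` is `½ ∫ σ(ζ_α ζ_α X) dt`. Summed over `α`, this is the difference between the
drifts of the two equations. In the converse direction the brackets hidden in the Stratonovich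
integrals are at first only known to have bounded variation. That is enough to treat them as drift,
compute the brackets as before, and identify them by uniqueness
(`solvesIto_iff_solvesStratonovich`).

The analytic core is `IsItoIntegral.tendsto_covSum`: the bracket of `∫ Z dY_α` with `Y_β` is `δ_{αβ}
∫ Z dt`, where the integral is known only as a limit in probability of left-point sums and `Z` has
no moments. The signals `h` contribute terms of bounded variation and drop out. For Brownian
integrators, each increment of the integral over a step of the partition is replaced by a left-point
sum on a finer grid, chosen diagonally. Freezing `Z` at the start of the step costs an error that
vanishes in L¹ after truncation (`tendstoInMeasure_blockSum`). In the frozen sum, `ΔW_α ΔW_β -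
δ_{αβ} Δt` is centred, independent of the past and of variance `O(Δt²)`, so it vanishes in L² after
truncation (`tendstoInMeasure_sum_mul_increment`). A Riemann sum remains.

The formula for the generator is checked channel by channel (`dissipator_sub_zeta_zeta`): because
`|e^{iθ}| = 1`, half of `ζ ∘ ζ` removes exactly the sandwich term `L* X L` of the dissipator. -/

lemma tendstoInMeasure_add {f g : ι → Ω → E} {f' g' : Ω → E} (hf : TendstoInMeasure μ f l f')
    (hg : TendstoInMeasure μ g l g') :
    TendstoInMeasure μ (fun i ω => f i ω + g i ω) l (fun ω => f' ω + g' ω) := by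
  intro ε hε
  have h := (hf (ε / 2) (ENNReal.half_pos hε.ne')).add (hg (ε / 2) (ENNReal.half_pos hε.ne'))
  rw [add_zero] at h
  refine tendsto_of_tendsto_of_tendsto_of_le_of_le tendsto_const_nhds h (fun _ => zero_le) ?_
  intro i
  refine (measure_mono ?_).trans (measure_union_le _ _)
  intro ω hω
  by_contra hcon
  simp only [Set.mem_union, Set.mem_ofPred_eq, not_or, not_le] at hcon hω
  have := (edist_add_add_le (f i ω) (g i ω) (f' ω) (g' ω)).trans_lt
    (ENNReal.add_lt_add hcon.1 hcon.2)
  rw [ENNReal.add_halves] at this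
  exact absurd hω (not_le.mpr this)

lemma tendstoInMeasure_neg {f : ι → Ω → E} {f' : Ω → E} (hf : TendstoInMeasure μ f l f') :
    TendstoInMeasure μ (fun i ω => -f i ω) l (fun ω => -f' ω) := by
  intro ε hε
  simpa only [edist_neg_neg] using hf ε hε

lemma tendstoInMeasure_sub {f g : ι → Ω → E} {f' g' : Ω → E} (hf : TendstoInMeasure μ f l f')
    (hg : TendstoInMeasure μ g l g') :
    TendstoInMeasure μ (fun i ω => f i ω - g i ω) l (fun ω => f' ω - g' ω) := by
  simpa only [sub_eq_add_neg] using tendstoInMeasure_add hf (tendstoInMeasure_neg hg)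

lemma tendstoInMeasure_const (g : Ω → E) : TendstoInMeasure μ (fun _ : ι => g) l g := by
  intro ε hε
  simpa [hε.ne'] using tendsto_const_nhds

lemma tendstoInMeasure_sum {κ : Type*} (s : Finset κ) {f : κ → ι → Ω → E} {f' : κ → Ω → E}
    (hf : ∀ a ∈ s, TendstoInMeasure μ (f a) l (f' a)) :
    TendstoInMeasure μ (fun i ω => ∑ a ∈ s, f a i ω) l (fun ω => ∑ a ∈ s, f' a ω) := by
  classical
  induction s using Finset.induction_on with
  | empty => simpa using tendstoInMeasure_const (fun _ : Ω => (0 : E))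
  | insert a s ha ih =>
    simp only [Finset.sum_insert ha]
    exact tendstoInMeasure_add (hf a (by simp)) (ih fun b hb => hf b (by simp [hb]))

/-- A sequence of convergent sequences can be replaced by approximations chosen diagonally. -/
lemma exists_diagonal_tendstoInMeasure {D : ℕ → ℕ → Ω → E} {D' : ℕ → Ω → E}
    (h : ∀ m, TendstoInMeasure μ (D m) atTop (D' m)) :
    ∃ k : ℕ → ℕ, TendstoInMeasure μ (fun m ω => D' m ω - D m (k m) ω) atTop (fun _ => 0) := by
  choose k hk using fun m => ExistsSeqTendstoAe.exists_nat_measure_lt_two_inv (h m) m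
  refine ⟨k, fun ε hε => ?_⟩
  have h0 : Tendsto (fun m : ℕ => (2⁻¹ : ℝ≥0∞) ^ m) atTop (𝓝 0) :=
    ENNReal.tendsto_pow_atTop_nhds_zero_of_lt_one (by simp)
  refine tendsto_of_tendsto_of_tendsto_of_le_of_le' tendsto_const_nhds h0
    (Eventually.of_forall fun _ => zero_le) ?_
  filter_upwards [h0.eventually (gt_mem_nhds hε)] with m hm
  refine (measure_mono ?_).trans (hk m (k m) le_rfl)
  intro ω hω
  simp only [Set.mem_ofPred_eq] at hω ⊢
  rw [edist_zero_right, ← edist_eq_enorm_sub, edist_comm] at hω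
  exact hm.le.trans hω

lemma tendstoInMeasure_zero_of_integral_norm {f : ι → Ω → E} (hf : ∀ i, Integrable (f i) μ)
    (h : Tendsto (fun i => ∫ ω, ‖f i ω‖ ∂μ) l (𝓝 0)) :
    TendstoInMeasure μ f l (fun _ => 0) := by
  refine tendstoInMeasure_of_tendsto_eLpNorm one_ne_zero
    (fun i => (hf i).aestronglyMeasurable) aestronglyMeasurable_const ?_
  have h1 := ENNReal.tendsto_ofReal h
  rw [ENNReal.ofReal_zero] at h1
  refine h1.congr fun i => ?_
  have : (f i - fun _ => (0 : E)) = f i := by ext; simp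
  rw [this, eLpNorm_one_eq_lintegral_enorm, ofReal_integral_norm_eq_lintegral_enorm (hf i)]

/-- The L¹ criterion applied to the squared norm, with level `ε ^ 2` in place of `ε`; this avoids
any measurability assumption on `f` itself. -/
lemma tendstoInMeasure_zero_of_integral_norm_sq {f : ι → Ω → E}
    (hf : ∀ i, Integrable (fun ω => ‖f i ω‖ ^ 2) μ)
    (h : Tendsto (fun i => ∫ ω, ‖f i ω‖ ^ 2 ∂μ) l (𝓝 0)) :
    TendstoInMeasure μ f l (fun _ => 0) := by
  have h1 := tendstoInMeasure_zero_of_integral_norm hf (by simpa using h)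
  rw [tendstoInMeasure_iff_norm] at h1 ⊢
  intro ε hε
  refine (h1 (ε ^ 2) (by positivity)).congr fun i => ?_
  congr 1
  ext ω
  simp only [sub_zero, Set.mem_ofPred_eq, norm_pow, norm_norm]
  exact pow_le_pow_iff_left₀ hε.le (norm_nonneg _) two_ne_zero

/-- Sequences that agree almost surely from some index on have the same limit in measure. -/
lemma tendstoInMeasure_of_ae_eventually_eq [IsFiniteMeasure μ] {f g : ℕ → Ω → E} {f' : Ω → E}
    (hf : ∀ m, AEStronglyMeasurable (f m) μ) (hg : ∀ m, AEStronglyMeasurable (g m) μ)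
    (h : ∀ᵐ ω ∂μ, ∀ᶠ m in atTop, f m ω = g m ω) (hlim : TendstoInMeasure μ g atTop f') :
    TendstoInMeasure μ f atTop f' := by
  have h0 : TendstoInMeasure μ (fun m ω => f m ω - g m ω) atTop (fun _ => 0) := by
    refine tendstoInMeasure_of_tendsto_ae (fun m => (hf m).sub (hg m)) ?_
    filter_upwards [h] with ω hω
    exact tendsto_const_nhds.congr' (hω.mono fun m hm => (sub_eq_zero.mpr hm).symm)
  simpa using tendstoInMeasure_add h0 hlim

end ConvergenceInMeasure

/-! ### Discrete stochastic sums and their isometry. -/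

section MartingaleSums

variable {Ω : Type*} {mΩ : MeasurableSpace Ω} {P : Measure Ω}

/-- Data of a sum `∑ cᵢ ξᵢ` of bounded predictable coefficients against independent centred
increments. -/
structure IsIncrementArray (P : Measure Ω) (𝓖 : ℕ → MeasurableSpace Ω) (ξ : ℕ → Ω → ℝ) : Prop where
  mono : Monotone 𝓖
  le : ∀ i, 𝓖 i ≤ mΩ
  measurable : ∀ i, StronglyMeasurable[𝓖 (i + 1)] (ξ i)
  indep : ∀ i, Indep (MeasurableSpace.comap (ξ i) inferInstance) (𝓖 i) P
  memLp : ∀ i, MemLp (ξ i) 2 P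
  mean : ∀ i, ∫ ω, ξ i ω ∂P = 0

namespace IsIncrementArray

variable {𝓖 : ℕ → MeasurableSpace Ω} {ξ : ℕ → Ω → ℝ} {c : ℕ → Ω → ℂ}

/-- Lets the isometry be used on a single block of a subdivided partition. -/
lemma shift (h : IsIncrementArray P 𝓖 ξ) (a : ℕ) :
    IsIncrementArray P (fun i => 𝓖 (a + i)) (fun i => ξ (a + i)) where
  mono _ _ hij := h.mono (by omega)
  le i := h.le _
  measurable i := h.measurable _
  indep i := h.indep _
  memLp i := h.memLp _
  mean i := h.mean _

lemma stronglyMeasurable_sum (h : IsIncrementArray P 𝓖 ξ)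
    (hc : ∀ i, StronglyMeasurable[𝓖 i] (c i)) (n : ℕ) :
    StronglyMeasurable[𝓖 n] (fun ω => ∑ i ∈ Finset.range n, c i ω * (ξ i ω : ℂ)) := by
  refine Finset.stronglyMeasurable_fun_sum _ fun i hi => ?_
  have hi := Finset.mem_range.mp hi
  exact ((hc i).mono (h.mono hi.le)).mul
    (Complex.continuous_ofReal.comp_stronglyMeasurable ((h.measurable i).mono (h.mono hi)))

lemma memLp_sum [IsFiniteMeasure P] (h : IsIncrementArray P 𝓖 ξ)
    (hc : ∀ i, StronglyMeasurable[𝓖 i] (c i)) {K : ℝ} (hK : ∀ i ω, ‖c i ω‖ ≤ K) (n : ℕ) :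
    MemLp (fun ω => ∑ i ∈ Finset.range n, c i ω * (ξ i ω : ℂ)) 2 P := by
  refine memLp_finsetSum _ fun i _ => ?_
  have h1 : MemLp (fun ω => (ξ i ω : ℂ)) 2 P := (h.memLp i).ofReal
  have h2 : MemLp (c i) ∞ P :=
    memLp_top_of_bound ((hc i).mono (h.le i)).aestronglyMeasurable K
      (Eventually.of_forall (hK i))
  exact h1.mul h2

lemma integral_mul_increment_eq_zero (h : IsIncrementArray P 𝓖 ξ) {i : ℕ} {g : Ω → ℝ}
    (hg : StronglyMeasurable[𝓖 i] g) : ∫ ω, g ω * ξ i ω ∂P = 0 := by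
  have hind : IndepFun g (ξ i) P := by
    refine (IndepFun_iff_Indep _ _ _).mpr ?_
    exact (indep_of_indep_of_le_right (h.indep i) hg.measurable.comap_le).symm
  rw [hind.integral_fun_mul_eq_mul_integral (hg.mono (h.le i)).aestronglyMeasurable
    (h.memLp i).1, h.mean i, mul_zero]

lemma integral_mul_increment_sq (h : IsIncrementArray P 𝓖 ξ) {i : ℕ} {g : Ω → ℝ}
    (hg : StronglyMeasurable[𝓖 i] g) :
    ∫ ω, g ω * ξ i ω ^ 2 ∂P = (∫ ω, g ω ∂P) * ∫ ω, ξ i ω ^ 2 ∂P := by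
  have hind : IndepFun g (fun ω => ξ i ω ^ 2) P := by
    refine (IndepFun_iff_Indep _ _ _).mpr ?_
    refine indep_of_indep_of_le_left (indep_of_indep_of_le_right (h.indep i).symm ?_)
      hg.measurable.comap_le
    exact ((comap_measurable (ξ i)).pow_const 2).comap_le
  exact hind.integral_fun_mul_eq_mul_integral (hg.mono (h.le i)).aestronglyMeasurable
    ((h.memLp i).1.pow 2)

/-- The discrete Itô isometry. The cross term of the last summand with the earlier ones is a `𝓖
n`-measurable factor times `ξ n`, hence has mean zero; in the square term independence factors the
expectation. -/
lemma integral_norm_sq_sum [IsFiniteMeasure P] (h : IsIncrementArray P 𝓖 ξ)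
    (hc : ∀ i, StronglyMeasurable[𝓖 i] (c i)) {K : ℝ} (hK : ∀ i ω, ‖c i ω‖ ≤ K) (n : ℕ) :
    ∫ ω, ‖∑ i ∈ Finset.range n, c i ω * (ξ i ω : ℂ)‖ ^ 2 ∂P =
      ∑ i ∈ Finset.range n, (∫ ω, ‖c i ω‖ ^ 2 ∂P) * ∫ ω, ξ i ω ^ 2 ∂P := by
  induction n with
  | zero => simp
  | succ n ih =>
    rw [Finset.sum_range_succ, ← ih]
    set S : Ω → ℂ := fun ω => ∑ i ∈ Finset.range n, c i ω * (ξ i ω : ℂ) with hS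
    have hSm : StronglyMeasurable[𝓖 n] S := h.stronglyMeasurable_sum hc n
    have hSL : MemLp S 2 P := h.memLp_sum hc hK n
    have hcm : MemLp (c n) ∞ P :=
      memLp_top_of_bound ((hc n).mono (h.le n)).aestronglyMeasurable K
        (Eventually.of_forall (hK n))
    have hcξ : MemLp (fun ω => c n ω * (ξ n ω : ℂ)) 2 P :=
      (show MemLp (fun ω => (ξ n ω : ℂ)) 2 P from (h.memLp n).ofReal).mul hcm
    let g : Ω → ℝ := fun ω => 2 * (inner ℝ (S ω) (c n ω))
    have hgm : StronglyMeasurable[𝓖 n] g := (hSm.inner (hc n)).const_mul 2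
    have hexp : ∀ ω, ‖∑ i ∈ Finset.range (n + 1), c i ω * (ξ i ω : ℂ)‖ ^ 2 =
        ‖S ω‖ ^ 2 + g ω * ξ n ω + ‖c n ω‖ ^ 2 * ξ n ω ^ 2 := by
      intro ω
      have h1 : c n ω * (ξ n ω : ℂ) = ξ n ω • c n ω := by
        rw [Complex.real_smul, mul_comm]
      rw [Finset.sum_range_succ, h1, norm_add_sq_real, inner_smul_right, norm_smul, mul_pow,
        Real.norm_eq_abs, sq_abs]
      simp only [g, S]
      ring
    have hg : Integrable (fun ω => g ω * ξ n ω) P := by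
      have : (fun ω => g ω * ξ n ω) = fun ω => 2 * (inner ℝ (S ω) (c n ω * (ξ n ω : ℂ))) := by
        ext ω
        have h1 : c n ω * (ξ n ω : ℂ) = ξ n ω • c n ω := by
          rw [Complex.real_smul, mul_comm]
        rw [h1, inner_smul_right]
        simp only [g]; ring
      rw [this]
      refine Integrable.const_mul ?_ 2
      refine (hSL.norm.integrable_mul hcξ.norm).mono' (hSL.1.inner hcξ.1)
        (Eventually.of_forall fun ω => ?_)
      exact norm_inner_le_norm _ _
    have hsq : Integrable (fun ω => ‖c n ω‖ ^ 2 * ξ n ω ^ 2) P := by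
      refine hcξ.norm.integrable_sq.congr (Eventually.of_forall fun ω => ?_)
      simp [mul_pow]
    rw [integral_congr_ae (Eventually.of_forall hexp), integral_add ?_ hsq, integral_add ?_ hg,
      h.integral_mul_increment_eq_zero hgm, add_zero,
      h.integral_mul_increment_sq (g := fun ω => ‖c n ω‖ ^ 2) ((hc n).norm.pow 2)]
    · exact hSL.norm.integrable_sq
    · exact (hSL.norm.integrable_sq).add hg

end IsIncrementArray

end MartingaleSums

/-! ### Second and fourth moments of Brownian increments. -/

section BrownianIncrements

variable {Ω : Type*} {mΩ : MeasurableSpace Ω} {P : Measure Ω}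

/-- The centred fourth moment of a standard normal variable, `𝔼 (X² - 1)²`. -/
def gaussianSqVariance : ℝ := ∫ x, (x ^ 2 - 1) ^ 2 ∂gaussianReal 0 1

lemma gaussianSqVariance_nonneg : 0 ≤ gaussianSqVariance :=
  integral_nonneg fun _ => sq_nonneg _

lemma integral_sq_gaussianReal (v : ℝ≥0) : ∫ x, x ^ 2 ∂gaussianReal 0 v = v := by
  have h := variance_fun_id_gaussianReal (μ := 0) (v := v)
  rwa [variance_of_integral_eq_zero (by fun_prop) (integral_id_gaussianReal)] at h

/-- Scaling: multiplication by `√v` carries the standard normal law to variance `v`. Only the factor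
`v ^ 2` matters later, so the constant is never evaluated. -/
lemma integral_sq_sub_var_sq_gaussianReal (v : ℝ≥0) :
    ∫ x, (x ^ 2 - v) ^ 2 ∂gaussianReal 0 v = gaussianSqVariance * v ^ 2 := by
  have h := gaussianReal_map_const_mul (μ := 0) (v := 1) (√(v : ℝ))
  have h2 : NNReal.mk (√(v : ℝ) ^ 2) (sq_nonneg _) * 1 = v := by
    ext; simp
  rw [mul_zero, h2] at h
  rw [← h, integral_map (by fun_prop) (by fun_prop), gaussianSqVariance, ← integral_mul_const]
  refine integral_congr_ae (Eventually.of_forall fun x => ?_)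
  simp only [mul_pow, Real.sq_sqrt v.coe_nonneg]
  ring

variable {B B' : ℝ≥0 → Ω → ℝ}

lemma _root_.ProbabilityTheory.IsPreBrownianReal.hasLaw_increment (hB : IsPreBrownianReal B P)
    {s t : ℝ≥0} (hst : s ≤ t) :
    HasLaw (fun ω => B t ω - B s ω) (gaussianReal 0 (t - s)) P := by
  have h := hB.hasLaw_sub t s
  have h2 : nndist (t : ℝ) (s : ℝ) = t - s := by
    ext
    rw [coe_nndist, Real.dist_eq, NNReal.coe_sub hst, abs_of_nonneg]
    exact sub_nonneg.mpr hst
  rwa [show nndist t.1 s.1 = t - s from h2] at h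

lemma _root_.ProbabilityTheory.IsPreBrownianReal.memLp_increment (hB : IsPreBrownianReal B P)
    {s t : ℝ≥0} (hst : s ≤ t) {p : ℝ≥0∞} (hp : p ≠ ∞) :
    MemLp (fun ω => B t ω - B s ω) p P := by
  have h := hB.hasLaw_increment hst
  have h1 := memLp_id_gaussianReal' (μ := 0) (v := t - s) p hp
  rw [← h.map_eq] at h1
  exact h1.comp_of_map h.aemeasurable

lemma _root_.ProbabilityTheory.IsPreBrownianReal.integral_increment (hB : IsPreBrownianReal B P)
    {s t : ℝ≥0} (hst : s ≤ t) : ∫ ω, (B t ω - B s ω) ∂P = 0 := by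
  rw [(hB.hasLaw_increment hst).integral_eq, integral_id_gaussianReal]

lemma _root_.ProbabilityTheory.IsPreBrownianReal.integral_increment_sq
    (hB : IsPreBrownianReal B P)
    {s t : ℝ≥0} (hst : s ≤ t) : ∫ ω, (B t ω - B s ω) ^ 2 ∂P = (t : ℝ) - s := by
  have h := (hB.hasLaw_increment hst).integral_comp (f := fun x : ℝ => x ^ 2) (by fun_prop)
  simp only [Function.comp_def] at h
  rw [h, integral_sq_gaussianReal, NNReal.coe_sub hst]

lemma _root_.ProbabilityTheory.IsPreBrownianReal.integral_increment_sq_sub_sq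
    (hB : IsPreBrownianReal B P) {s t : ℝ≥0} (hst : s ≤ t) :
    ∫ ω, ((B t ω - B s ω) ^ 2 - ((t : ℝ) - s)) ^ 2 ∂P =
      gaussianSqVariance * ((t : ℝ) - s) ^ 2 := by
  have h := (hB.hasLaw_increment hst).integral_comp
    (f := fun x : ℝ => (x ^ 2 - ((t : ℝ) - s)) ^ 2) (by fun_prop)
  simp only [Function.comp_def] at h
  rw [h, ← NNReal.coe_sub hst, integral_sq_sub_var_sq_gaussianReal]

end BrownianIncrements

/-! ### Partitions and their equal subdivisions. -/

section Partitions

namespace Partition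

variable {t : ℝ≥0} (π : Partition t)

lemma pt_le {i : ℕ} (hi : i ≤ π.size) : π.pt i ≤ t :=
  (π.mono hi).trans_eq π.pt_size

lemma step_le_mesh {i : ℕ} (hi : i < π.size) : π.pt (i + 1) - π.pt i ≤ π.mesh :=
  Finset.le_sup (f := fun i => π.pt (i + 1) - π.pt i) (Finset.mem_range.mpr hi)

lemma sub_nonneg (i : ℕ) : 0 ≤ (π.pt (i + 1) : ℝ) - π.pt i :=
  _root_.sub_nonneg.mpr (NNReal.coe_le_coe.mpr (π.mono (Nat.le_succ i)))

lemma sub_le_mesh {i : ℕ} (hi : i < π.size) : (π.pt (i + 1) : ℝ) - π.pt i ≤ π.mesh := by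
  rw [← NNReal.coe_sub (π.mono (Nat.le_succ i))]
  exact NNReal.coe_le_coe.mpr (π.step_le_mesh hi)

lemma sum_sub : ∑ i ∈ Finset.range π.size, ((π.pt (i + 1) : ℝ) - π.pt i) = t := by
  rw [Finset.sum_range_sub (fun i => (π.pt i : ℝ)), π.pt_size, π.pt_zero]
  simp

end Partition

/-- The points obtained by cutting every step of `p` into `K` equal parts. -/
def subdivide (p : ℕ → ℝ≥0) (K l : ℕ) : ℝ≥0 :=
  p (l / K) + (l % K : ℕ) * ((p (l / K + 1) - p (l / K)) / K)

variable {p : ℕ → ℝ≥0} {K : ℕ}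

lemma subdivide_mul (hK : 0 < K) (i : ℕ) : subdivide p K (K * i) = p i := by
  simp [subdivide, hK]

lemma subdivide_succ (hp : Monotone p) (hK : 0 < K) (l : ℕ) :
    subdivide p K (l + 1) = subdivide p K l + (p (l / K + 1) - p (l / K)) / K := by
  have hK0 : (K : ℝ≥0) ≠ 0 := by exact_mod_cast hK.ne'
  have hlt := Nat.mod_lt l hK
  have hdm := Nat.div_add_mod l K
  generalize hi : l / K = i at *
  generalize hj : l % K = j at *
  by_cases h : j + 1 < K
  · have hd : (l + 1) / K = i := by
      rw [← hdm, add_assoc, Nat.mul_add_div hK, Nat.div_eq_of_lt h, add_zero]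
    have hm : (l + 1) % K = j + 1 := by
      rw [← hdm, add_assoc, Nat.mul_add_mod, Nat.mod_eq_of_lt h]
    simp only [subdivide, hd, hm, hi, hj]
    push_cast
    ring
  -- The last part of a step: `l + 1` is the index of the original point `p (i + 1)`, so quotient
  -- and remainder both jump.
  · have hjK : j + 1 = K := by omega
    have hl : l + 1 = K * (i + 1) := by rw [← hdm, add_assoc, hjK]; ring
    rw [hl, subdivide_mul hK]
    simp only [subdivide, hi, hj]
    have hle : p i ≤ p (i + 1) := hp (Nat.le_succ i)
    have : ((j : ℝ≥0) + 1) * ((p (i + 1) - p i) / K) = p (i + 1) - p i := by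
      rw [show (j : ℝ≥0) + 1 = K by exact_mod_cast hjK]
      field_simp
    rw [add_assoc, ← add_one_mul, this, add_tsub_cancel_of_le hle]

lemma subdivide_mono (hp : Monotone p) (hK : 0 < K) : Monotone (subdivide p K) :=
  monotone_nat_of_le_succ fun l => by rw [subdivide_succ hp hK]; exact le_self_add

lemma le_subdivide (l : ℕ) : p (l / K) ≤ subdivide p K l := le_self_add

lemma subdivide_le (hp : Monotone p) (hK : 0 < K) (l : ℕ) : subdivide p K l ≤ p (l / K + 1) := by
  rw [← subdivide_mul (p := p) hK (l / K + 1)]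
  refine subdivide_mono hp hK ?_
  rw [mul_add, mul_one]
  calc l = K * (l / K) + l % K := (Nat.div_add_mod l K).symm
    _ ≤ _ := Nat.add_le_add_left (Nat.mod_lt l hK).le _

/-- The first `K * i` steps of a subdivision, as a partition of `[0, p i]`. -/
def subdividePartition (hp : Monotone p) (h0 : p 0 = 0) (hK : 0 < K) (i : ℕ) :
    Partition (p i) where
  size := K * i
  pt := subdivide p K
  mono := subdivide_mono hp hK
  pt_zero := by rw [← mul_zero K, subdivide_mul hK, h0]
  pt_size := subdivide_mul hK i

lemma mesh_subdividePartition_le (hp : Monotone p) (h0 : p 0 = 0) (hK : 0 < K) (i : ℕ) :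
    (subdividePartition hp h0 hK i).mesh ≤ p i / K := by
  refine Finset.sup_le fun l hl => ?_
  have hl' : l < K * i := Finset.mem_range.mp hl
  have hdiv : l / K < i := (Nat.div_lt_iff_lt_mul hK).mpr (by rwa [mul_comm])
  simp only [subdividePartition]
  rw [subdivide_succ hp hK, add_tsub_cancel_left]
  gcongr
  exact tsub_le_self.trans (hp hdiv)

lemma tendsto_mesh_subdividePartition (hp : Monotone p) (h0 : p 0 = 0) (i : ℕ) :
    Tendsto (fun k : ℕ => (subdividePartition hp h0 k.succ_pos i).mesh) atTop (𝓝 0) := by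
  have h : Tendsto (fun k : ℕ => p i / ((k + 1 : ℕ) : ℝ≥0)) atTop (𝓝 0) :=
    (tendsto_const_div_atTop_nhds_zero_nat (𝕜 := ℝ≥0) (p i)).comp (tendsto_add_atTop_nat 1)
  exact tendsto_of_tendsto_of_tendsto_of_le_of_le tendsto_const_nhds h (fun _ => zero_le)
    fun k => mesh_subdividePartition_le hp h0 k.succ_pos i

/-- Limits required along all partition sequences say something only if such a sequence exists;
measurability of the integral and uniqueness of the bracket rest on this. -/
lemma exists_partition_tendsto_mesh (t : ℝ≥0) :
    ∃ π : ℕ → Partition t, Tendsto (fun m => (π m).mesh) atTop (𝓝 0) := by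
  have hp : Monotone (fun i : ℕ => if i = 0 then (0 : ℝ≥0) else t) :=
    monotone_nat_of_le_succ fun i => by
      by_cases h : i = 0 <;> simp [h]
  exact ⟨fun k => subdividePartition hp rfl k.succ_pos 1, tendsto_mesh_subdividePartition hp rfl 1⟩

lemma sum_range_mul {M : Type*} [AddCommMonoid M] (f : ℕ → M) (K n : ℕ) :
    ∑ l ∈ Finset.range (K * n), f l =
      ∑ i ∈ Finset.range n, ∑ j ∈ Finset.range K, f (K * i + j) := by
  induction n with
  | zero => simp
  | succ n ih => rw [mul_add, mul_one, Finset.sum_range_add, ih, Finset.sum_range_succ]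

end Partitions

/-! ### Pathwise estimates: uniform continuity, bounded variation, Riemann sums. -/

section Paths

variable {E F : Type*} [NormedAddCommGroup E] [NormedAddCommGroup F]

/-- Uniform continuity on `[0, t]`. All points `s` of a step are allowed, not just its end, so that
subdivision points and integration variables are covered. -/
lemma eventually_norm_sub_le_of_mesh {f : ℝ≥0 → E} (hf : Continuous f) {t : ℝ≥0}
    {π : ℕ → Partition t} (hπ : Tendsto (fun m => (π m).mesh) atTop (𝓝 0)) {ε : ℝ} (hε : 0 < ε) :
    ∀ᶠ m in atTop, ∀ i < (π m).size, ∀ s, (π m).pt i ≤ s → s ≤ (π m).pt (i + 1) →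
      ‖f s - f ((π m).pt i)‖ ≤ ε := by
  have huc : UniformContinuousOn f (Set.Icc 0 t) :=
    isCompact_Icc.uniformContinuousOn_of_continuous hf.continuousOn
  obtain ⟨δ, hδ, h⟩ := Metric.uniformContinuousOn_iff.mp huc ε hε
  have hδ' : (0 : ℝ≥0) < ⟨δ, hδ.le⟩ := hδ
  filter_upwards [hπ.eventually (gt_mem_nhds hδ')] with m hm i hi s his hsi
  rw [← dist_eq_norm]
  refine (h s ⟨zero_le, hsi.trans ((π m).pt_le hi)⟩ _ ⟨zero_le, (π m).pt_le hi.le⟩ ?_).le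
  rw [NNReal.dist_eq, abs_of_nonneg (sub_nonneg.mpr (NNReal.coe_le_coe.mpr his))]
  have h1 : (s : ℝ) - (π m).pt i ≤ (π m).mesh :=
    (sub_le_sub_right (NNReal.coe_le_coe.mpr hsi) _).trans ((π m).sub_le_mesh hi)
  exact h1.trans_lt hm

lemma exists_norm_le_of_continuous {f : ℝ≥0 → E} (hf : Continuous f) (t : ℝ≥0) :
    ∃ C, 0 ≤ C ∧ ∀ s ≤ t, ‖f s‖ ≤ C := by
  obtain ⟨C, hC⟩ := (isCompact_Icc (a := (0 : ℝ≥0)) (b := t)).exists_bound_of_continuousOn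
    hf.continuousOn
  exact ⟨max C 0, le_max_right _ _, fun s hs => (hC s ⟨zero_le, hs⟩).trans (le_max_left _ _)⟩

/-- The sums of the norms of the increments of `f` over the partitions of `[0, T]` are bounded. -/
def HasBoundedIncrementSums (f : ℝ≥0 → E) : Prop :=
  ∀ T : ℝ≥0, ∃ C : ℝ, ∀ p : ℕ → ℝ≥0, Monotone p → ∀ n, p n ≤ T →
    ∑ i ∈ Finset.range n, ‖f (p (i + 1)) - f (p i)‖ ≤ C

namespace HasBoundedIncrementSums

variable {f g : ℝ≥0 → E}

lemma add (hf : HasBoundedIncrementSums f) (hg : HasBoundedIncrementSums g) :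
    HasBoundedIncrementSums (fun t => f t + g t) := by
  intro T
  obtain ⟨C, hC⟩ := hf T
  obtain ⟨D, hD⟩ := hg T
  refine ⟨C + D, fun p hp n hn => ?_⟩
  refine le_trans ?_ (add_le_add (hC p hp n hn) (hD p hp n hn))
  rw [← Finset.sum_add_distrib]
  refine Finset.sum_le_sum fun i _ => ?_
  rw [add_sub_add_comm]
  exact norm_add_le _ _

lemma const (c : E) : HasBoundedIncrementSums (fun _ => c) :=
  fun _ => ⟨0, fun p _ n _ => by simp⟩

lemma sum {κ : Type*} (s : Finset κ) {f : κ → ℝ≥0 → E}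
    (hf : ∀ a ∈ s, HasBoundedIncrementSums (f a)) :
    HasBoundedIncrementSums (fun t => ∑ a ∈ s, f a t) := by
  classical
  induction s using Finset.induction_on with
  | empty => simpa using const (0 : E)
  | insert a s ha ih =>
    simp only [Finset.sum_insert ha]
    exact (hf a (by simp)).add (ih fun b hb => hf b (by simp [hb]))

lemma const_mul {f : ℝ≥0 → ℂ} (hf : HasBoundedIncrementSums f) (c : ℂ) :
    HasBoundedIncrementSums (fun t => c * f t) := by
  intro T
  obtain ⟨C, hC⟩ := hf T
  refine ⟨‖c‖ * C, fun p hp n hn => ?_⟩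
  simp only [← mul_sub, norm_mul, ← Finset.mul_sum]
  exact mul_le_mul_of_nonneg_left (hC p hp n hn) (norm_nonneg _)

lemma of_locallyBoundedVariationOn (hf : LocallyBoundedVariationOn f Set.univ) :
    HasBoundedIncrementSums f := by
  intro T
  have hT : eVariationOn f (Set.univ ∩ Set.Icc 0 T) ≠ ∞ := hf 0 T trivial trivial
  refine ⟨(eVariationOn f (Set.univ ∩ Set.Icc 0 T)).toReal, fun p hp n hn => ?_⟩
  have h := eVariationOn.sum_le_of_monotoneOn_Iic (f := f) (s := Set.univ ∩ Set.Icc 0 T)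
    (u := p) (n := n) (hp.monotoneOn _) fun i hi => ⟨trivial, zero_le, (hp hi).trans hn⟩
  have h2 := ENNReal.toReal_mono hT h
  rw [ENNReal.toReal_sum fun i _ => edist_ne_top _ _] at h2
  simpa only [edist_dist, ENNReal.toReal_ofReal dist_nonneg, dist_eq_norm,
    ENNReal.toReal_ofReal (norm_nonneg _)] using h2

lemma locallyBoundedVariationOn (hf : HasBoundedIncrementSums f) :
    LocallyBoundedVariationOn f Set.univ := by
  intro a b _ _
  obtain ⟨C, hC⟩ := hf b
  refine ne_top_of_le_ne_top (ENNReal.ofReal_ne_top (r := C)) ?_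
  refine iSup_le fun q => ?_
  obtain ⟨n, u, hu, hus⟩ := q
  have h := hC u hu n (hus n).2.2
  calc ∑ i ∈ Finset.range n, edist (f (u (i + 1))) (f (u i))
      = ENNReal.ofReal (∑ i ∈ Finset.range n, ‖f (u (i + 1)) - f (u i)‖) := by
        rw [ENNReal.ofReal_sum_of_nonneg fun i _ => norm_nonneg _]
        simp only [edist_dist, dist_eq_norm]
    _ ≤ ENNReal.ofReal C := ENNReal.ofReal_le_ofReal h

/-- The increments of a primitive are dominated by the integrals of `‖g‖` over the steps, which add
up. -/
lemma integral [NormedSpace ℝ E] {g : ℝ → E}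
    (hg : ∀ t : ℝ≥0, IntervalIntegrable g volume 0 t) :
    HasBoundedIncrementSums (fun t : ℝ≥0 => ∫ s in (0 : ℝ)..t, g s) := by
  intro T
  refine ⟨∫ s in (0 : ℝ)..T, ‖g s‖, fun p hp n hn => ?_⟩
  have hint : ∀ a b : ℝ≥0, IntervalIntegrable g volume a b :=
    fun a b => (hg a).symm.trans (hg b)
  calc ∑ i ∈ Finset.range n, ‖(∫ s in (0 : ℝ)..p (i + 1), g s) - ∫ s in (0 : ℝ)..p i, g s‖
      ≤ ∑ i ∈ Finset.range n, ∫ s in (p i : ℝ)..p (i + 1), ‖g s‖ := by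
        refine Finset.sum_le_sum fun i _ => ?_
        rw [intervalIntegral.integral_interval_sub_left (hg _) (hg _)]
        exact intervalIntegral.norm_integral_le_integral_norm
          (NNReal.coe_le_coe.mpr (hp (Nat.le_succ i)))
    _ = ∫ s in (p 0 : ℝ)..p n, ‖g s‖ :=
        intervalIntegral.sum_integral_adjacent_intervals (a := fun i => (p i : ℝ))
          fun i _ => (hint _ _).norm
    _ ≤ ∫ s in (0 : ℝ)..T, ‖g s‖ := by
        refine intervalIntegral.integral_mono_interval (p 0).coe_nonneg
          (NNReal.coe_le_coe.mpr (hp (Nat.zero_le n))) (NNReal.coe_le_coe.mpr hn)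
          (Eventually.of_forall fun _ => norm_nonneg _) (hg T).norm

/-- A path of bounded variation has vanishing covariation with every continuous path. -/
lemma tendsto_sum_mul_norm (hf : HasBoundedIncrementSums f) {g : ℝ≥0 → F} (hg : Continuous g)
    {t : ℝ≥0} {π : ℕ → Partition t} (hπ : Tendsto (fun m => (π m).mesh) atTop (𝓝 0)) :
    Tendsto (fun m => ∑ i ∈ Finset.range (π m).size,
      ‖f ((π m).pt (i + 1)) - f ((π m).pt i)‖ * ‖g ((π m).pt (i + 1)) - g ((π m).pt i)‖)
      atTop (𝓝 0) := by
  obtain ⟨C, hC⟩ := hf t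
  have hC0 : 0 ≤ C := by simpa using hC (fun _ => 0) monotone_const 0 zero_le
  rw [Metric.tendsto_atTop']
  intro ε hε
  have hε' : 0 < ε / (C + 1) := by positivity
  obtain ⟨N, hN⟩ := eventually_atTop.mp (eventually_norm_sub_le_of_mesh hg hπ hε')
  refine ⟨N, fun m hm => ?_⟩
  rw [Real.dist_eq, sub_zero, abs_of_nonneg
    (Finset.sum_nonneg fun i _ => mul_nonneg (norm_nonneg _) (norm_nonneg _))]
  calc _ ≤ ∑ i ∈ Finset.range (π m).size,
        ‖f ((π m).pt (i + 1)) - f ((π m).pt i)‖ * (ε / (C + 1)) := by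
        refine Finset.sum_le_sum fun i hi => mul_le_mul_of_nonneg_left ?_ (norm_nonneg _)
        exact hN m hm.le i (Finset.mem_range.mp hi) _ ((π m).mono (Nat.le_succ i)) le_rfl
    _ ≤ C * (ε / (C + 1)) := by
        rw [← Finset.sum_mul]
        exact mul_le_mul_of_nonneg_right (hC _ (π m).mono _ (π m).pt_size.le) hε'.le
    _ < ε := by
        rw [← mul_div_assoc, div_lt_iff₀ (by positivity)]
        nlinarith

end HasBoundedIncrementSums

lemma continuous_integral_of_intervalIntegrable [NormedSpace ℝ E] {g : ℝ → E}
    (hg : ∀ t : ℝ≥0, IntervalIntegrable g volume 0 t) :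
    Continuous (fun t : ℝ≥0 => ∫ s in (0 : ℝ)..t, g s) := by
  rw [continuous_iff_continuousAt]
  intro t
  -- The interval ends at `t + 1` so that `Set.Iic (t + 1)` is a neighbourhood of `t`.
  have h := intervalIntegral.continuousOn_primitive_interval'
    (hg (t + 1)) (by simp : (0 : ℝ) ∈ Set.uIcc 0 ((t + 1 : ℝ≥0) : ℝ))
  have hc : ContinuousOn (fun t : ℝ≥0 => ∫ s in (0 : ℝ)..t, g s) (Set.Iic (t + 1)) := by
    refine h.comp NNReal.continuous_coe.continuousOn fun s hs => ?_
    rw [Set.uIcc_of_le (NNReal.coe_nonneg _)]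
    exact ⟨s.coe_nonneg, NNReal.coe_le_coe.mpr hs⟩
  exact hc.continuousAt (Iic_mem_nhds (lt_add_of_pos_right t one_pos))

/-- Left-point sums of a continuous path against an absolutely continuous one. -/
lemma tendsto_sum_mul_integral {Z : ℝ≥0 → ℂ} (hZ : Continuous Z) {g : ℝ → ℝ}
    (hg : ∀ t : ℝ≥0, IntervalIntegrable g volume 0 t)
    {t : ℝ≥0} {π : ℕ → Partition t} (hπ : Tendsto (fun m => (π m).mesh) atTop (𝓝 0)) :
    Tendsto (fun m => ∑ i ∈ Finset.range (π m).size, Z ((π m).pt i) *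
      (((∫ s in (0 : ℝ)..(π m).pt (i + 1), g s) - ∫ s in (0 : ℝ)..(π m).pt i, g s : ℝ) : ℂ))
      atTop (𝓝 (∫ s in (0 : ℝ)..t, Z s.toNNReal * (g s : ℂ))) := by
  have hint : ∀ a b : ℝ≥0, IntervalIntegrable g volume a b :=
    fun a b => (hg a).symm.trans (hg b)
  have hofr : ∀ a b : ℝ≥0, IntervalIntegrable (fun s => (g s : ℂ)) volume a b :=
    fun a b => ⟨(hint a b).1.ofReal, (hint a b).2.ofReal⟩
  have hZc : Continuous fun s : ℝ => Z s.toNNReal := hZ.comp continuous_real_toNNReal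
  have hZg : ∀ a b : ℝ≥0, IntervalIntegrable (fun s => Z s.toNNReal * (g s : ℂ)) volume a b :=
    fun a b => (hofr a b).continuousOn_mul hZc.continuousOn
  set D : ℝ := ∫ s in (0 : ℝ)..t, |g s| with hD
  have hD0 : 0 ≤ D := intervalIntegral.integral_nonneg t.coe_nonneg fun _ _ => abs_nonneg _
  rw [Metric.tendsto_atTop']
  intro ε hε
  have hε' : 0 < ε / (D + 1) := by positivity
  obtain ⟨N, hN⟩ := eventually_atTop.mp (eventually_norm_sub_le_of_mesh hZ hπ hε')
  refine ⟨N, fun m hm => ?_⟩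
  have hsum : ∫ s in (0 : ℝ)..t, Z s.toNNReal * (g s : ℂ) = ∑ i ∈ Finset.range (π m).size,
      ∫ s in ((π m).pt i : ℝ)..(π m).pt (i + 1), Z s.toNNReal * (g s : ℂ) := by
    rw [intervalIntegral.sum_integral_adjacent_intervals (a := fun i => ((π m).pt i : ℝ))
      fun i _ => hZg _ _, (π m).pt_zero, (π m).pt_size, NNReal.coe_zero]
  have hsumD : D = ∑ i ∈ Finset.range (π m).size,
      ∫ s in ((π m).pt i : ℝ)..(π m).pt (i + 1), |g s| := by
    rw [intervalIntegral.sum_integral_adjacent_intervals (a := fun i => ((π m).pt i : ℝ))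
      fun i _ => (hint _ _).abs, (π m).pt_zero, (π m).pt_size, NNReal.coe_zero]
  rw [dist_comm, dist_eq_norm, hsum, ← Finset.sum_sub_distrib]
  calc _ ≤ ∑ i ∈ Finset.range (π m).size,
        (ε / (D + 1)) * ∫ s in ((π m).pt i : ℝ)..(π m).pt (i + 1), |g s| := by
        refine norm_sum_le_of_le _ fun i hi => ?_
        have hle : ((π m).pt i : ℝ) ≤ (π m).pt (i + 1) :=
          NNReal.coe_le_coe.mpr ((π m).mono (Nat.le_succ i))
        rw [intervalIntegral.integral_interval_sub_left (hg _) (hg _),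
          ← intervalIntegral.integral_ofReal, ← intervalIntegral.integral_const_mul,
          ← intervalIntegral.integral_sub (hZg _ _) ((hofr _ _).const_mul _),
          ← intervalIntegral.integral_const_mul]
        refine intervalIntegral.norm_integral_le_of_norm_le hle
          (Eventually.of_forall fun s hs => ?_) ((hint _ _).abs.const_mul _)
        rw [← sub_mul, norm_mul, Complex.norm_real, Real.norm_eq_abs]
        refine mul_le_mul_of_nonneg_right ?_ (abs_nonneg _)
        refine hN m hm.le i (Finset.mem_range.mp hi) _ ?_ ?_
        · exact NNReal.le_toNNReal_of_coe_le hs.1.le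
        · exact Real.toNNReal_le_iff_le_coe.mpr hs.2
    _ = ε / (D + 1) * D := by rw [← Finset.mul_sum, ← hsumD]
    _ < ε := by
        rw [div_mul_eq_mul_div, div_lt_iff₀ (by positivity)]
        nlinarith

lemma tendsto_sum_mul_sub {Z : ℝ≥0 → ℂ} (hZ : Continuous Z)
    {t : ℝ≥0} {π : ℕ → Partition t} (hπ : Tendsto (fun m => (π m).mesh) atTop (𝓝 0)) :
    Tendsto (fun m => ∑ i ∈ Finset.range (π m).size, Z ((π m).pt i) *
      (((π m).pt (i + 1) - (π m).pt i : ℝ) : ℂ))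
      atTop (𝓝 (∫ s in (0 : ℝ)..t, Z s.toNNReal)) := by
  have h := tendsto_sum_mul_integral hZ (g := fun _ => 1) (fun t => by simp) hπ
  simpa using h

end Paths

/-! ### Compensated products of Brownian increments, and the law of large numbers for them. -/

section BrownianArrays

variable {Ω : Type*} {mΩ : MeasurableSpace Ω} {P : Measure Ω}
  {𝓕 : Filtration ℝ≥0 mΩ} {ι : Type*} {W : ι → ℝ≥0 → Ω → ℝ}

namespace IsBrownianFamily

/-- The vector of all increments is independent of the past, so functions mixing several components
are too; products `ΔW_α ΔW_β` need this joint form. -/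
lemma indep_comp_increments (hW : IsBrownianFamily P 𝓕 W) {s t : ℝ≥0} (hst : s ≤ t)
    {φ : (ι → ℝ) → ℝ} (hφ : Measurable φ) :
    Indep (MeasurableSpace.comap (fun ω => φ fun α => W α t ω - W α s ω) inferInstance)
      (𝓕 s) P := by
  refine indep_of_indep_of_le_left (hW.increments s t hst) ?_
  exact (hφ.comp (comap_measurable fun ω α => W α t ω - W α s ω)).comap_le

lemma stronglyMeasurable_increment (hW : IsBrownianFamily P 𝓕 W) (α : ι) {s t : ℝ≥0}
    (hst : s ≤ t) : StronglyMeasurable[𝓕 t] (fun ω => W α t ω - W α s ω) :=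
  (hW.adapted α t).sub ((hW.adapted α s).mono (𝓕.mono hst))

lemma indepFun_increment (hW : IsBrownianFamily P 𝓕 W) {α β : ι} (hαβ : α ≠ β) (s t : ℝ≥0) :
    IndepFun (fun ω => W α t ω - W α s ω) (fun ω => W β t ω - W β s ω) P := by
  have hφ : Measurable fun w : ℝ≥0 → ℝ => w t - w s :=
    (measurable_pi_apply t).sub (measurable_pi_apply s)
  exact (hW.independent.indepFun hαβ).comp hφ hφ

lemma isIncrementArray (hW : IsBrownianFamily P 𝓕 W) (α : ι) {p : ℕ → ℝ≥0} (hp : Monotone p) :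
    IsIncrementArray P (fun i => 𝓕 (p i)) (fun i ω => W α (p (i + 1)) ω - W α (p i) ω) where
  mono _ _ hij := 𝓕.mono (hp hij)
  le _ := 𝓕.le _
  measurable i := hW.stronglyMeasurable_increment α (hp (Nat.le_succ i))
  indep i := hW.indep_comp_increments (hp (Nat.le_succ i)) (measurable_pi_apply α)
  memLp i := (hW.brownian α).memLp_increment (hp (Nat.le_succ i)) (p := 2) (by simp)
  mean i := (hW.brownian α).integral_increment (hp (Nat.le_succ i))

variable [DecidableEq ι]

/-- The compensated product `ΔW_α ΔW_β - δ_{αβ} Δt`. -/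
def _root_.BelavkinZakai.compensatedProduct (W : ι → ℝ≥0 → Ω → ℝ) (α β : ι) (s t : ℝ≥0)
    (ω : Ω) : ℝ :=
  (W α t ω - W α s ω) * (W β t ω - W β s ω) - if α = β then (t : ℝ) - s else 0

lemma memLp_compensatedProduct [IsProbabilityMeasure P] (hW : IsBrownianFamily P 𝓕 W)
    (α β : ι) {s t : ℝ≥0} (hst : s ≤ t) : MemLp (compensatedProduct W α β s t) 2 P := by
  -- The product of two increments is square integrable because each has a fourth moment.
  have h4 : ENNReal.HolderTriple 4 4 2 := by
    constructor
    rw [← ENNReal.toReal_eq_toReal_iff' (by simp) (by simp),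
      ENNReal.toReal_add (by simp) (by simp)]
    simp only [ENNReal.toReal_inv, ENNReal.toReal_ofNat]
    norm_num
  have ha := (hW.brownian α).memLp_increment hst (p := 4) (by simp)
  have hb := (hW.brownian β).memLp_increment hst (p := 4) (by simp)
  exact (MemLp.mul (r := 2) (p := 4) (q := 4) hb ha).sub (memLp_const _)

lemma integral_compensatedProduct [IsProbabilityMeasure P] (hW : IsBrownianFamily P 𝓕 W)
    (α β : ι) {s t : ℝ≥0} (hst : s ≤ t) : ∫ ω, compensatedProduct W α β s t ω ∂P = 0 := by
  have ha := (hW.brownian α).memLp_increment hst (p := 2) (by simp)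
  have hb := (hW.brownian β).memLp_increment hst (p := 2) (by simp)
  simp only [compensatedProduct]
  have hab : Integrable (fun ω => (W α t ω - W α s ω) * (W β t ω - W β s ω)) P :=
    ha.integrable_mul hb
  rw [integral_sub hab (integrable_const _)]
  by_cases h : α = β
  · subst h
    have h2 := (hW.brownian α).integral_increment_sq hst
    simp only [pow_two] at h2
    simp [h2]
  · rw [(hW.indepFun_increment h s t).integral_fun_mul_eq_mul_integral ha.1 hb.1,
      (hW.brownian α).integral_increment hst]
    simp [h]

/-- One constant for two cases: for `α = β` the integral is `gaussianSqVariance` times `Δt²`, and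
for `α ≠ β` independence gives `Δt²` exactly. -/
lemma integral_compensatedProduct_sq_le (hW : IsBrownianFamily P 𝓕 W) (α β : ι) {s t : ℝ≥0}
    (hst : s ≤ t) : ∫ ω, compensatedProduct W α β s t ω ^ 2 ∂P ≤
      (1 + gaussianSqVariance) * ((t : ℝ) - s) ^ 2 := by
  have hsq : 0 ≤ ((t : ℝ) - s) ^ 2 := sq_nonneg _
  have hG := gaussianSqVariance_nonneg
  by_cases h : α = β
  · subst h
    have h2 := (hW.brownian α).integral_increment_sq_sub_sq hst
    simp only [compensatedProduct, if_true, ← pow_two, h2]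
    nlinarith
  · have ha := (hW.brownian α).memLp_increment hst (p := 2) (by simp)
    have hb := (hW.brownian β).memLp_increment hst (p := 2) (by simp)
    have hind := (hW.indepFun_increment h s t).comp (φ := fun x : ℝ => x ^ 2)
      (ψ := fun x : ℝ => x ^ 2) (by fun_prop) (by fun_prop)
    have h1 := hind.integral_fun_mul_eq_mul_integral (ha.1.pow 2) (hb.1.pow 2)
    simp only [Function.comp_def, (hW.brownian α).integral_increment_sq hst,
      (hW.brownian β).integral_increment_sq hst] at h1
    simp only [compensatedProduct, h, if_false, sub_zero, mul_pow, h1]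
    nlinarith [mul_nonneg hG hsq]

lemma isIncrementArray_compensatedProduct [IsProbabilityMeasure P]
    (hW : IsBrownianFamily P 𝓕 W) (α β : ι) {p : ℕ → ℝ≥0} (hp : Monotone p) :
    IsIncrementArray P (fun i => 𝓕 (p i))
      (fun i => compensatedProduct W α β (p i) (p (i + 1))) where
  mono _ _ hij := 𝓕.mono (hp hij)
  le _ := 𝓕.le _
  measurable i := ((hW.stronglyMeasurable_increment α (hp (Nat.le_succ i))).mul
    (hW.stronglyMeasurable_increment β (hp (Nat.le_succ i)))).sub stronglyMeasurable_const
  indep i := hW.indep_comp_increments (hp (Nat.le_succ i))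
    (φ := fun x => x α * x β - if α = β then (p (i + 1) : ℝ) - p i else 0)
    (((measurable_pi_apply α).mul (measurable_pi_apply β)).sub measurable_const)
  memLp i := hW.memLp_compensatedProduct α β (hp (Nat.le_succ i))
  mean i := hW.integral_compensatedProduct α β (hp (Nat.le_succ i))

end IsBrownianFamily

/-- Sums of a continuous adapted process against centred increments with variances
`O((Δt)²)` vanish in the limit. -/
lemma tendstoInMeasure_sum_mul_increment [IsProbabilityMeasure P] {Z : ℝ≥0 → Ω → ℂ} (hZa : StronglyAdapted 𝓕 Z)
    (hZc : ∀ᵐ ω ∂P, Continuous fun t => Z t ω) {t : ℝ≥0} {π : ℕ → Partition t}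
    (hπ : Tendsto (fun m => (π m).mesh) atTop (𝓝 0)) {ξ : ℕ → ℕ → Ω → ℝ}
    (hξ : ∀ m, IsIncrementArray P (fun i => 𝓕 ((π m).pt i)) (ξ m)) {C : ℝ} (hC0 : 0 ≤ C)
    (hC : ∀ m i, ∫ ω, ξ m i ω ^ 2 ∂P ≤ C * ((π m).pt (i + 1) - (π m).pt i : ℝ) ^ 2) :
    TendstoInMeasure P
      (fun m ω => ∑ i ∈ Finset.range (π m).size, Z ((π m).pt i) ω * (ξ m i ω : ℂ))
      atTop (fun _ => 0) := by
  -- The scale `r m` tends to zero while `mesh ≤ r m ^ 2`; the summand `1 / (m + 1)` keeps it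
  -- positive when the mesh vanishes.
  let r : ℕ → ℝ := fun m => √((π m).mesh + 1 / ((m : ℝ) + 1))
  have hpos : ∀ m : ℕ, (0 : ℝ) < (π m).mesh + 1 / ((m : ℝ) + 1) := fun m => by positivity
  have hr0 : ∀ m, 0 < r m := fun m => Real.sqrt_pos.mpr (hpos m)
  have hmesh : ∀ m, ((π m).mesh : ℝ) ≤ r m * r m := fun m => by
    rw [Real.mul_self_sqrt (hpos m).le]
    exact le_add_of_nonneg_right (by positivity)
  have hr : Tendsto r atTop (𝓝 0) := by
    have h1 := ((NNReal.tendsto_coe.mpr hπ).add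
      (tendsto_one_div_add_atTop_nhds_zero_nat (𝕜 := ℝ))).sqrt
    simpa [r] using h1
  -- `Z` need not have moments, so it is cut off where `‖Z‖ ^ 2 > 1 / r m`. The cut looks only at
  -- the left point and so stays adapted. The isometry then bounds the second moment by `C * t *
  -- mesh / r m ≤ C * t * r m`.
  let c : ℕ → ℕ → Ω → ℂ := fun m i ω =>
    if ‖Z ((π m).pt i) ω‖ ^ 2 * r m ≤ 1 then Z ((π m).pt i) ω else 0
  have hcm : ∀ m i, StronglyMeasurable[𝓕 ((π m).pt i)] (c m i) := fun m i => by
    refine StronglyMeasurable.ite ?_ (hZa _) stronglyMeasurable_const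
    exact (((hZa ((π m).pt i)).norm.pow 2).mul stronglyMeasurable_const).measurableSet_le
      stronglyMeasurable_const
  have hcsq : ∀ m i ω, ‖c m i ω‖ ^ 2 ≤ 1 / r m := fun m i ω => by
    simp only [c]
    split_ifs with h
    · rwa [le_div_iff₀ (hr0 m)]
    · simp [(hr0 m).le]
  have hcb : ∀ m i ω, ‖c m i ω‖ ≤ √(1 / r m) := fun m i ω =>
    Real.le_sqrt_of_sq_le (hcsq m i ω)
  have hlim : TendstoInMeasure P
      (fun m ω => ∑ i ∈ Finset.range (π m).size, c m i ω * (ξ m i ω : ℂ))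
      atTop (fun _ => 0) := by
    refine tendstoInMeasure_zero_of_integral_norm_sq
      (fun m => ((hξ m).memLp_sum (hcm m) (hcb m) _).norm.integrable_sq) ?_
    have hup : Tendsto (fun m => C * t * r m) atTop (𝓝 0) := by
      simpa using hr.const_mul (C * t)
    refine squeeze_zero (fun m => integral_nonneg fun _ => sq_nonneg _) (fun m => ?_) hup
    rw [(hξ m).integral_norm_sq_sum (hcm m) (hcb m)]
    calc _ ≤ ∑ i ∈ Finset.range (π m).size,
          C * r m * ((π m).pt (i + 1) - (π m).pt i : ℝ) := by
          refine Finset.sum_le_sum fun i hi => ?_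
          have hint : ∫ ω, ‖c m i ω‖ ^ 2 ∂P ≤ 1 / r m := by
            refine (integral_mono_of_nonneg (Eventually.of_forall fun _ => sq_nonneg _)
              (integrable_const (1 / r m)) (Eventually.of_forall (hcsq m i))).trans_eq ?_
            simp
          have hd0 := (π m).sub_nonneg i
          have hd1 : ((π m).pt (i + 1) - (π m).pt i : ℝ) ≤ r m * r m :=
            ((π m).sub_le_mesh (Finset.mem_range.mp hi)).trans (hmesh m)
          calc _ ≤ (1 / r m) * (C * ((π m).pt (i + 1) - (π m).pt i : ℝ) ^ 2) :=
                mul_le_mul hint (hC m i) (integral_nonneg fun _ => sq_nonneg _)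
                  (one_div_nonneg.mpr (hr0 m).le)
            _ = (C * ((π m).pt (i + 1) - (π m).pt i : ℝ) / r m) *
                  ((π m).pt (i + 1) - (π m).pt i : ℝ) := by ring
            _ ≤ (C * ((π m).pt (i + 1) - (π m).pt i : ℝ) / r m) * (r m * r m) :=
                mul_le_mul_of_nonneg_left hd1
                  (div_nonneg (mul_nonneg hC0 hd0) (hr0 m).le)
            _ = _ := by field_simp [(hr0 m).ne']
      _ = C * t * r m := by rw [← Finset.mul_sum, (π m).sum_sub]; ring
  refine tendstoInMeasure_of_ae_eventually_eq (fun m => ?_) (fun m => ?_) ?_ hlim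
  · exact (((hξ m).stronglyMeasurable_sum (fun i => hZa _) _).mono
      ((hξ m).le _)).aestronglyMeasurable
  · exact (((hξ m).stronglyMeasurable_sum (hcm m) _).mono ((hξ m).le _)).aestronglyMeasurable
  -- A continuous path is bounded on `[0, t]` and `1 / r m` tends to infinity, so the cutoff is
  -- eventually inactive.
  · filter_upwards [hZc] with ω hω
    obtain ⟨D, hD0, hD⟩ := exists_norm_le_of_continuous hω t
    have h1 : Tendsto (fun m => D ^ 2 * r m) atTop (𝓝 0) := by
      simpa using hr.const_mul (D ^ 2)
    filter_upwards [h1.eventually (gt_mem_nhds one_pos)] with m hm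
    refine Finset.sum_congr rfl fun i hi => ?_
    have h2 : ‖Z ((π m).pt i) ω‖ ^ 2 * r m ≤ 1 := by
      refine le_trans ?_ hm.le
      refine mul_le_mul_of_nonneg_right ?_ (hr0 m).le
      exact pow_le_pow_left₀ (norm_nonneg _)
        (hD _ ((π m).pt_le (Finset.mem_range.mp hi).le)) 2
    simp only [c, if_pos h2]

end BrownianArrays

/-! ### The error of freezing the integrand on each step. -/

section BlockSums

variable {Ω : Type*} {mΩ : MeasurableSpace Ω} {P : Measure Ω}
  {𝓕 : Filtration ℝ≥0 mΩ} {ι : Type*} {W : ι → ℝ≥0 → Ω → ℝ}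

/-- The `l`-th step of the subdivision of `π` into `K` parts per step. -/
def subStep {t : ℝ≥0} (π : Partition t) (K l : ℕ) : ℝ :=
  (subdivide π.pt K (l + 1) : ℝ) - subdivide π.pt K l

lemma subStep_nonneg {t : ℝ≥0} (π : Partition t) {K : ℕ} (hK : 0 < K) (l : ℕ) :
    0 ≤ subStep π K l :=
  sub_nonneg.mpr (NNReal.coe_le_coe.mpr (subdivide_mono π.mono hK (Nat.le_succ l)))

lemma sum_subStep {t : ℝ≥0} (π : Partition t) {K : ℕ} (hK : 0 < K) :
    ∑ l ∈ Finset.range (K * π.size), subStep π K l = t := by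
  simp only [subStep]
  rw [Finset.sum_range_sub (fun l => (subdivide π.pt K l : ℝ)), subdivide_mul hK, π.pt_size]
  rw [← mul_zero K, subdivide_mul hK, π.pt_zero]
  simp

/-- The increment of `Z` from the last point of `π`, cut off where it exceeds `1`. -/
def cutIncrement {t : ℝ≥0} (π : Partition t) (K : ℕ) (Z : ℝ≥0 → Ω → ℂ) (l : ℕ) (ω : Ω) : ℂ :=
  if ‖Z (subdivide π.pt K l) ω - Z (π.pt (l / K)) ω‖ ≤ 1 then
    Z (subdivide π.pt K l) ω - Z (π.pt (l / K)) ω else 0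

lemma norm_cutIncrement_le_one {t : ℝ≥0} (π : Partition t) (K : ℕ) (Z : ℝ≥0 → Ω → ℂ) (l : ℕ)
    (ω : Ω) : ‖cutIncrement π K Z l ω‖ ≤ 1 := by
  unfold cutIncrement
  split_ifs with h
  · exact h
  · simp

lemma norm_cutIncrement_le {t : ℝ≥0} (π : Partition t) (K : ℕ) (Z : ℝ≥0 → Ω → ℂ) (l : ℕ)
    (ω : Ω) : ‖cutIncrement π K Z l ω‖ ≤
      ‖Z (subdivide π.pt K l) ω - Z (π.pt (l / K)) ω‖ := by
  unfold cutIncrement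
  split_ifs with h
  · exact le_rfl
  · simp

lemma stronglyMeasurable_subdivide_sub {Z : ℝ≥0 → Ω → ℂ} (hZa : StronglyAdapted 𝓕 Z) {t : ℝ≥0}
    (π : Partition t) (K l : ℕ) : StronglyMeasurable[𝓕 (subdivide π.pt K l)]
      (fun ω => Z (subdivide π.pt K l) ω - Z (π.pt (l / K)) ω) :=
  (hZa _).sub ((hZa _).mono (𝓕.mono (le_subdivide l)))

lemma stronglyMeasurable_cutIncrement {Z : ℝ≥0 → Ω → ℂ} (hZa : StronglyAdapted 𝓕 Z) {t : ℝ≥0}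
    (π : Partition t) (K l : ℕ) :
    StronglyMeasurable[𝓕 (subdivide π.pt K l)] (cutIncrement π K Z l) := by
  have h := stronglyMeasurable_subdivide_sub hZa π K l
  exact StronglyMeasurable.ite (h.norm.measurableSet_le stronglyMeasurable_const) h
    stronglyMeasurable_const

lemma eventually_norm_subdivide_sub_le {f : ℝ≥0 → ℂ} (hf : Continuous f) {t : ℝ≥0}
    {π : ℕ → Partition t} (hπ : Tendsto (fun m => (π m).mesh) atTop (𝓝 0)) {K : ℕ → ℕ}
    (hK : ∀ m, 0 < K m) {ε : ℝ} (hε : 0 < ε) :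
    ∀ᶠ m in atTop, ∀ l < K m * (π m).size,
      ‖f (subdivide (π m).pt (K m) l) - f ((π m).pt (l / K m))‖ ≤ ε := by
  filter_upwards [eventually_norm_sub_le_of_mesh hf hπ hε] with m hm l hl
  exact hm _ ((Nat.div_lt_iff_lt_mul (hK m)).mpr (by rwa [mul_comm])) _ (le_subdivide l)
    (subdivide_le (π m).mono (hK m) l)

/-- The quadratic sum of the cut increments. -/
def cutEnergy {t : ℝ≥0} (π : Partition t) (K : ℕ) (Z : ℝ≥0 → Ω → ℂ) (ω : Ω) : ℝ :=
  ∑ l ∈ Finset.range (K * π.size), ‖cutIncrement π K Z l ω‖ ^ 2 * subStep π K l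

lemma cutEnergy_nonneg {t : ℝ≥0} (π : Partition t) {K : ℕ} (hK : 0 < K) (Z : ℝ≥0 → Ω → ℂ)
    (ω : Ω) : 0 ≤ cutEnergy π K Z ω :=
  Finset.sum_nonneg fun l _ => mul_nonneg (sq_nonneg _) (subStep_nonneg π hK l)

lemma cutEnergy_le {t : ℝ≥0} (π : Partition t) {K : ℕ} (hK : 0 < K) (Z : ℝ≥0 → Ω → ℂ)
    {ω : Ω} {ε : ℝ} (h : ∀ l < K * π.size, ‖cutIncrement π K Z l ω‖ ≤ ε) :
    cutEnergy π K Z ω ≤ ε ^ 2 * t := by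
  rw [← sum_subStep π hK, Finset.mul_sum]
  refine Finset.sum_le_sum fun l hl => mul_le_mul_of_nonneg_right ?_ (subStep_nonneg π hK l)
  exact pow_le_pow_left₀ (norm_nonneg _) (h l (Finset.mem_range.mp hl)) 2

/-- Dominated convergence: the cut at `1` bounds the energy by `t`, and on a continuous path all
increments within a step become uniformly small. -/
lemma tendsto_integral_cutEnergy [IsProbabilityMeasure P] {Z : ℝ≥0 → Ω → ℂ}
    (hZa : StronglyAdapted 𝓕 Z)
    (hZc : ∀ᵐ ω ∂P, Continuous fun t => Z t ω) {t : ℝ≥0} {π : ℕ → Partition t}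
    (hπ : Tendsto (fun m => (π m).mesh) atTop (𝓝 0)) {K : ℕ → ℕ} (hK : ∀ m, 0 < K m) :
    Tendsto (fun m => ∫ ω, cutEnergy (π m) (K m) Z ω ∂P) atTop (𝓝 0) := by
  have h := tendsto_integral_of_dominated_convergence (μ := P) (f := fun _ => (0 : ℝ))
    (F := fun m ω => cutEnergy (π m) (K m) Z ω) (fun _ => (t : ℝ)) (fun m => ?_)
    (integrable_const _) (fun m => Eventually.of_forall fun ω => ?_) ?_
  · simpa using h
  · refine Finset.aestronglyMeasurable_fun_sum _ fun l _ => ?_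
    exact ((((stronglyMeasurable_cutIncrement hZa (π m) (K m) l).mono
      (𝓕.le _)).norm.pow 2).mul stronglyMeasurable_const).aestronglyMeasurable
  · rw [Real.norm_of_nonneg (cutEnergy_nonneg _ (hK m) _ _)]
    simpa using cutEnergy_le (π m) (hK m) Z (ω := ω) (ε := 1)
      fun l _ => norm_cutIncrement_le_one _ _ _ _ _
  · filter_upwards [hZc] with ω hω
    rw [Metric.tendsto_atTop']
    intro ε hε
    have hε' : 0 < √(ε / (t + 1)) := Real.sqrt_pos.mpr (by positivity)
    obtain ⟨N, hN⟩ := eventually_atTop.mp (eventually_norm_subdivide_sub_le hω hπ hK hε')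
    refine ⟨N, fun m hm => ?_⟩
    rw [Real.dist_eq, sub_zero, abs_of_nonneg (cutEnergy_nonneg _ (hK m) _ _)]
    refine (cutEnergy_le (π m) (hK m) Z fun l hl =>
      (norm_cutIncrement_le _ _ _ _ _).trans (hN m hm.le l hl)).trans_lt ?_
    rw [Real.sq_sqrt (by positivity), div_mul_eq_mul_div, div_lt_iff₀ (by positivity)]
    nlinarith [t.coe_nonneg]

/-- The sum over the steps of `π` of a stochastic sum over the parts of the step times the
increment of another motion. -/
def blockSum {t : ℝ≥0} (π : Partition t) (K : ℕ) (W W' : ℝ≥0 → Ω → ℝ) (c : ℕ → Ω → ℂ)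
    (ω : Ω) : ℂ :=
  ∑ i ∈ Finset.range π.size,
    (∑ j ∈ Finset.range K, c (K * i + j) ω *
      ((W (subdivide π.pt K (K * i + j + 1)) ω - W (subdivide π.pt K (K * i + j)) ω : ℝ) : ℂ)) *
    ((W' (π.pt (i + 1)) ω - W' (π.pt i) ω : ℝ) : ℂ)

lemma aestronglyMeasurable_blockSum (hW : IsBrownianFamily P 𝓕 W) (α β : ι) {t : ℝ≥0}
    (π : Partition t) (K : ℕ) {c : ℕ → Ω → ℂ} (hc : ∀ l, AEStronglyMeasurable (c l) P) :
    AEStronglyMeasurable (blockSum π K (W α) (W β) c) P := by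
  have hWm : ∀ α t, AEStronglyMeasurable (W α t) P := fun α t =>
    ((hW.adapted α t).mono (𝓕.le t)).aestronglyMeasurable
  refine Finset.aestronglyMeasurable_fun_sum _ fun i _ => ?_
  refine (Finset.aestronglyMeasurable_fun_sum _ fun j _ => ?_).mul ?_
  · exact (hc _).mul (Complex.continuous_ofReal.comp_aestronglyMeasurable
      ((hWm α _).sub (hWm α _)))
  · exact Complex.continuous_ofReal.comp_aestronglyMeasurable ((hWm β _).sub (hWm β _))

/-- Each term is a product `R * V` with `R` an inner sum and `V` an increment of `W β`. These need
not be independent, so the product is bounded by `x * R² + V² / x`. The isometry sums the first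
parts to the energy and the second parts to `t / x`; the free `x` is taken large before the energy
is sent to zero. -/
lemma integral_norm_blockSum_cutIncrement_le [IsProbabilityMeasure P]
    (hW : IsBrownianFamily P 𝓕 W) (α β : ι)
    {Z : ℝ≥0 → Ω → ℂ} (hZa : StronglyAdapted 𝓕 Z) {t : ℝ≥0}
    (π : Partition t) {K : ℕ} (hK : 0 < K) :
    Integrable (blockSum π K (W α) (W β) (cutIncrement π K Z)) P ∧ ∀ x : ℝ, 0 < x →
    ∫ ω, ‖blockSum π K (W α) (W β) (cutIncrement π K Z) ω‖ ∂P ≤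
      x * (∫ ω, cutEnergy π K Z ω ∂P) + t / x := by
  have hs := subdivide_mono π.mono hK
  have harr := hW.isIncrementArray α hs
  set c := cutIncrement π K Z with hc
  let R : ℕ → Ω → ℂ := fun i ω => ∑ j ∈ Finset.range K, c (K * i + j) ω *
    ((W α (subdivide π.pt K (K * i + j + 1)) ω - W α (subdivide π.pt K (K * i + j)) ω : ℝ) : ℂ)
  let V : ℕ → Ω → ℝ := fun i ω => W β (π.pt (i + 1)) ω - W β (π.pt i) ω
  have hV : ∀ i, MemLp (V i) 2 P := fun i =>
    (hW.brownian β).memLp_increment (π.mono (Nat.le_succ i)) (by simp)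
  have hR : ∀ i, MemLp (R i) 2 P := fun i =>
    (harr.shift (K * i)).memLp_sum (fun j => stronglyMeasurable_cutIncrement hZa π K _)
      (K := 1) (fun j ω => norm_cutIncrement_le_one _ _ _ _ _) K
  have hRsq : ∀ i, ∫ ω, ‖R i ω‖ ^ 2 ∂P =
      ∑ j ∈ Finset.range K, (∫ ω, ‖c (K * i + j) ω‖ ^ 2 ∂P) * subStep π K (K * i + j) := by
    intro i
    refine ((harr.shift (K * i)).integral_norm_sq_sum
      (fun j => stronglyMeasurable_cutIncrement hZa π K _)
      (K := 1) (fun j ω => norm_cutIncrement_le_one _ _ _ _ _) K).trans ?_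
    refine Finset.sum_congr rfl fun j _ => ?_
    rw [(hW.brownian α).integral_increment_sq (hs (Nat.le_succ _))]
    rfl
  have hcint : ∀ l, Integrable (fun ω => ‖c l ω‖ ^ 2) P := fun l => by
    refine Integrable.of_bound ((((stronglyMeasurable_cutIncrement hZa π K l).mono
      (𝓕.le _)).norm.pow 2).aestronglyMeasurable) 1 (Eventually.of_forall fun ω => ?_)
    rw [norm_pow, norm_norm]
    exact pow_le_one₀ (norm_nonneg _) (norm_cutIncrement_le_one _ _ _ _ _)
  have henergy : ∑ i ∈ Finset.range π.size, ∫ ω, ‖R i ω‖ ^ 2 ∂P =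
      ∫ ω, cutEnergy π K Z ω ∂P := by
    simp only [cutEnergy]
    rw [integral_finsetSum _ fun l _ => (hcint l).mul_const _, sum_range_mul]
    refine Finset.sum_congr rfl fun i _ => ?_
    rw [hRsq]
    exact Finset.sum_congr rfl fun j _ => (integral_mul_const _ _).symm
  have hRV : ∀ i, Integrable (fun ω => R i ω * (V i ω : ℂ)) P := fun i =>
    (hR i).integrable_mul (show MemLp (fun ω => (V i ω : ℂ)) 2 P from (hV i).ofReal)
  refine ⟨integrable_finsetSum _ fun i _ => hRV i, fun x hx => ?_⟩
  have hdom : Integrable (fun ω => ∑ i ∈ Finset.range π.size,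
      (x * ‖R i ω‖ ^ 2 + V i ω ^ 2 / x)) P :=
    integrable_finsetSum _ fun i _ =>
      ((hR i).norm.integrable_sq.const_mul x).add ((hV i).integrable_sq.div_const x)
  calc ∫ ω, ‖blockSum π K (W α) (W β) c ω‖ ∂P
      ≤ ∫ ω, ∑ i ∈ Finset.range π.size, (x * ‖R i ω‖ ^ 2 + V i ω ^ 2 / x) ∂P := by
        refine integral_mono_of_nonneg (Eventually.of_forall fun _ => norm_nonneg _) hdom
          (Eventually.of_forall fun ω => norm_sum_le_of_le _ fun i _ => ?_)
        rw [norm_mul, Complex.norm_real, Real.norm_eq_abs, ← sq_abs (W β _ ω - W β _ ω)]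
        change ‖R i ω‖ * |V i ω| ≤ x * ‖R i ω‖ ^ 2 + |V i ω| ^ 2 / x
        rw [← sub_nonneg]
        -- Completing the square leaves a nonnegative multiple of the product to spare.
        have : x * ‖R i ω‖ ^ 2 + |V i ω| ^ 2 / x - ‖R i ω‖ * |V i ω| =
            ((x * ‖R i ω‖ - |V i ω|) ^ 2 + x * (‖R i ω‖ * |V i ω|)) / x := by
          field_simp
          ring
        rw [this]
        positivity
    _ = ∑ i ∈ Finset.range π.size, (x * (∫ ω, ‖R i ω‖ ^ 2 ∂P) +
          ((π.pt (i + 1) : ℝ) - π.pt i) / x) := by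
        have hi : ∀ i, Integrable (fun ω => x * ‖R i ω‖ ^ 2 + V i ω ^ 2 / x) P := fun i =>
          ((hR i).norm.integrable_sq.const_mul x).add ((hV i).integrable_sq.div_const x)
        rw [integral_finsetSum _ fun i _ => hi i]
        refine Finset.sum_congr rfl fun i _ => ?_
        rw [integral_add ((hR i).norm.integrable_sq.const_mul x)
          ((hV i).integrable_sq.div_const x), integral_const_mul, integral_div,
          (hW.brownian β).integral_increment_sq (π.mono (Nat.le_succ i))]
    _ = x * (∫ ω, cutEnergy π K Z ω ∂P) + t / x := by
        rw [Finset.sum_add_distrib, ← Finset.mul_sum, henergy, ← Finset.sum_div, π.sum_sub]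

/-- The error of freezing the integrand over each step of the partition does not contribute to
the covariation. -/
lemma tendstoInMeasure_blockSum [IsProbabilityMeasure P]
    (hW : IsBrownianFamily P 𝓕 W) (α β : ι)
    {Z : ℝ≥0 → Ω → ℂ} (hZa : StronglyAdapted 𝓕 Z)
    (hZc : ∀ᵐ ω ∂P, Continuous fun t => Z t ω) {t : ℝ≥0} {π : ℕ → Partition t}
    (hπ : Tendsto (fun m => (π m).mesh) atTop (𝓝 0)) {K : ℕ → ℕ} (hK : ∀ m, 0 < K m) :
    TendstoInMeasure P (fun m => blockSum (π m) (K m) (W α) (W β) fun l ω =>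
      Z (subdivide (π m).pt (K m) l) ω - Z ((π m).pt (l / K m)) ω) atTop (fun _ => 0) := by
  have hbd := fun m => integral_norm_blockSum_cutIncrement_le hW α β hZa (π m) (hK m)
  have hlim : TendstoInMeasure P
      (fun m => blockSum (π m) (K m) (W α) (W β) (cutIncrement (π m) (K m) Z))
      atTop (fun _ => 0) := by
    refine tendstoInMeasure_zero_of_integral_norm (fun m => (hbd m).1) ?_
    rw [Metric.tendsto_atTop']
    intro ε hε
    -- With this `x` the term `t / x` is at most `ε / 2`; the energy term supplies the other half
    -- for large `m`.
    have hx : 0 < 2 * (t + 1 : ℝ) / ε := by positivity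
    have h1 := (tendsto_integral_cutEnergy hZa hZc hπ hK).const_mul (2 * (t + 1 : ℝ) / ε)
    rw [mul_zero] at h1
    obtain ⟨N, hN⟩ := eventually_atTop.mp (h1.eventually (gt_mem_nhds (half_pos hε)))
    refine ⟨N, fun m hm => ?_⟩
    rw [Real.dist_eq, sub_zero, abs_of_nonneg (integral_nonneg fun _ => norm_nonneg _)]
    have h2 := (hbd m).2 _ hx
    have h3 := hN m hm.le
    have h4 : (t : ℝ) / (2 * (t + 1 : ℝ) / ε) ≤ ε / 2 := by
      rw [div_div_eq_mul_div, div_le_iff₀ (by positivity)]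
      nlinarith
    linarith
  refine tendstoInMeasure_of_ae_eventually_eq (fun m => ?_) (fun m => ?_) ?_ hlim
  · exact aestronglyMeasurable_blockSum hW α β _ _ fun l =>
      ((stronglyMeasurable_subdivide_sub hZa _ _ l).mono (𝓕.le _)).aestronglyMeasurable
  · exact (hbd m).1.aestronglyMeasurable
  · filter_upwards [hZc] with ω hω
    filter_upwards [eventually_norm_subdivide_sub_le hω hπ hK one_pos] with m hm
    refine Finset.sum_congr rfl fun i hi => ?_
    congr 1
    refine Finset.sum_congr rfl fun j hj => ?_
    have hl : K m * i + j < K m * (π m).size := by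
      have := Nat.mul_le_mul_left (K m) (Nat.succ_le_of_lt (Finset.mem_range.mp hi))
      rw [Nat.mul_succ] at this
      have := Finset.mem_range.mp hj
      omega
    simp only [cutIncrement, if_pos (hm _ hl)]

end BlockSums

/-! ### Covariation of an Itô integral with a Brownian motion. -/

section Covariation

variable {Ω : Type*} {mΩ : MeasurableSpace Ω} {P : Measure Ω}
  {𝓕 : Filtration ℝ≥0 mΩ} {ι : Type*} {W : ι → ℝ≥0 → Ω → ℝ}

/-- `V` may be unbounded, so levels cannot simply be rescaled; instead almost sure convergence is
extracted along subsequences, where multiplication is harmless. -/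
lemma tendstoInMeasure_mul_right [IsFiniteMeasure P] {X : ℕ → Ω → ℂ} {X' V : Ω → ℂ}
    (hX : ∀ k, AEStronglyMeasurable (X k) P) (hV : AEStronglyMeasurable V P)
    (h : TendstoInMeasure P X atTop X') :
    TendstoInMeasure P (fun k ω => X k ω * V ω) atTop (fun ω => X' ω * V ω) := by
  have hXV : ∀ k, AEStronglyMeasurable (fun ω => X k ω * V ω) P := fun k => (hX k).mul hV
  rw [exists_seq_tendstoInMeasure_atTop_iff hXV]
  intro ns hns
  obtain ⟨ns', hns', hlim⟩ := (exists_seq_tendstoInMeasure_atTop_iff hX).mp h ns hns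
  exact ⟨ns', hns', hlim.mono fun ω hω => hω.mul_const _⟩

/-- The sum of the products of the increments of `Z` and `Y` along a partition. -/
def covSum {t : ℝ≥0} (π : Partition t) (Z : ℝ≥0 → Ω → ℂ) (Y : ℝ≥0 → Ω → ℝ) (ω : Ω) : ℂ :=
  ∑ i ∈ Finset.range π.size, (Z (π.pt (i + 1)) ω - Z (π.pt i) ω) *
    ((Y (π.pt (i + 1)) ω - Y (π.pt i) ω : ℝ) : ℂ)

lemma norm_covSum_le {t : ℝ≥0} (π : Partition t) (Z : ℝ≥0 → Ω → ℂ) (Y : ℝ≥0 → Ω → ℝ) (ω : Ω) :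
    ‖covSum π Z Y ω‖ ≤ ∑ i ∈ Finset.range π.size,
      ‖Z (π.pt (i + 1)) ω - Z (π.pt i) ω‖ * ‖Y (π.pt (i + 1)) ω - Y (π.pt i) ω‖ :=
  norm_sum_le_of_le _ fun i _ => by rw [norm_mul, Complex.norm_real]

lemma aestronglyMeasurable_covSum {t : ℝ≥0} (π : Partition t) {Z : ℝ≥0 → Ω → ℂ}
    {Y : ℝ≥0 → Ω → ℝ} (hZ : ∀ t, AEStronglyMeasurable (Z t) P)
    (hY : ∀ t, AEStronglyMeasurable (Y t) P) : AEStronglyMeasurable (covSum π Z Y) P :=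
  Finset.aestronglyMeasurable_fun_sum _ fun _ _ => ((hZ _).sub (hZ _)).mul
    (Complex.continuous_ofReal.comp_aestronglyMeasurable ((hY _).sub (hY _)))

/-- A process with paths of bounded variation has no covariation with a continuous one. -/
lemma tendstoInMeasure_covSum_of_boundedVariation_left [IsFiniteMeasure P] {B : ℝ≥0 → Ω → ℂ}
    {Y : ℝ≥0 → Ω → ℝ} (hBm : ∀ t, AEStronglyMeasurable (B t) P)
    (hYm : ∀ t, AEStronglyMeasurable (Y t) P)
    (hB : ∀ᵐ ω ∂P, HasBoundedIncrementSums fun t => B t ω)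
    (hY : ∀ᵐ ω ∂P, Continuous fun t => Y t ω) {t : ℝ≥0} {π : ℕ → Partition t}
    (hπ : Tendsto (fun m => (π m).mesh) atTop (𝓝 0)) :
    TendstoInMeasure P (fun m => covSum (π m) B Y) atTop (fun _ => 0) := by
  refine tendstoInMeasure_of_tendsto_ae (fun m => aestronglyMeasurable_covSum _ hBm hYm) ?_
  filter_upwards [hB, hY] with ω h1 h2
  exact squeeze_zero_norm (fun m => norm_covSum_le _ _ _ _) (h1.tendsto_sum_mul_norm h2 hπ)

lemma tendstoInMeasure_covSum_of_boundedVariation_right [IsFiniteMeasure P] {M : ℝ≥0 → Ω → ℂ}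
    {V : ℝ≥0 → Ω → ℝ} (hMm : ∀ t, AEStronglyMeasurable (M t) P)
    (hVm : ∀ t, AEStronglyMeasurable (V t) P)
    (hM : ∀ᵐ ω ∂P, Continuous fun t => M t ω)
    (hV : ∀ᵐ ω ∂P, HasBoundedIncrementSums fun t => V t ω) {t : ℝ≥0} {π : ℕ → Partition t}
    (hπ : Tendsto (fun m => (π m).mesh) atTop (𝓝 0)) :
    TendstoInMeasure P (fun m => covSum (π m) M V) atTop (fun _ => 0) := by
  refine tendstoInMeasure_of_tendsto_ae (fun m => aestronglyMeasurable_covSum _ hMm hVm) ?_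
  filter_upwards [hM, hV] with ω h1 h2
  refine squeeze_zero_norm (fun m => (norm_covSum_le _ _ _ _).trans_eq ?_)
    (h2.tendsto_sum_mul_norm h1 hπ)
  exact Finset.sum_congr rfl fun i _ => mul_comm _ _

/-- Measurability is not part of the definition of the integral; it is inherited from the
approximating sums. -/
lemma IsItoIntegral.aestronglyMeasurable {Z J : ℝ≥0 → Ω → ℂ} {Y : ℝ≥0 → Ω → ℝ}
    (hJ : IsItoIntegral P Z Y J) (hZ : ∀ t, AEStronglyMeasurable (Z t) P)
    (hY : ∀ t, AEStronglyMeasurable (Y t) P) (t : ℝ≥0) : AEStronglyMeasurable (J t) P := by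
  obtain ⟨π, hπ⟩ := exists_partition_tendsto_mesh t
  refine (hJ.tendsto t π hπ).aestronglyMeasurable fun m => ?_
  exact Finset.aestronglyMeasurable_fun_sum _ fun _ _ => (hZ _).mul
    (Complex.continuous_ofReal.comp_aestronglyMeasurable ((hY _).sub (hY _)))

/-- An increment of an Itô integral over a step of a partition is the limit of the left-point
sums over the subdivisions of that step. -/
lemma IsItoIntegral.tendsto_increment {Z M : ℝ≥0 → Ω → ℂ} {Y : ℝ≥0 → Ω → ℝ}
    (hM : IsItoIntegral P Z Y M) {t : ℝ≥0} (π : Partition t) (i : ℕ) :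
    TendstoInMeasure P (fun k ω => ∑ j ∈ Finset.range (k + 1),
      Z (subdivide π.pt (k + 1) ((k + 1) * i + j)) ω *
        ((Y (subdivide π.pt (k + 1) ((k + 1) * i + j + 1)) ω -
          Y (subdivide π.pt (k + 1) ((k + 1) * i + j)) ω : ℝ) : ℂ))
      atTop (fun ω => M (π.pt (i + 1)) ω - M (π.pt i) ω) := by
  have h := fun i => hM.tendsto (π.pt i)
    (fun k => subdividePartition π.mono π.pt_zero k.succ_pos i)
    (tendsto_mesh_subdividePartition π.mono π.pt_zero i)
  refine (tendstoInMeasure_sub (h (i + 1)) (h i)).congr_left fun k => ?_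
  refine Eventually.of_forall fun ω => ?_
  simp only [subdividePartition, Nat.succ_eq_add_one]
  rw [mul_add (k + 1) i 1, mul_one, Finset.sum_range_add, add_sub_cancel_left]

/-- Here `π` is fixed and only the subdivision is refined, so the outer sum is finite and each
increment of `W β` is a fixed factor. -/
lemma IsItoIntegral.tendsto_blockSum [IsProbabilityMeasure P] (hW : IsBrownianFamily P 𝓕 W)
    {α : ι} (β : ι)
    {Z M : ℝ≥0 → Ω → ℂ} (hZa : StronglyAdapted 𝓕 Z) (hM : IsItoIntegral P Z (W α) M) {t : ℝ≥0}
    (π : Partition t) :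
    TendstoInMeasure P (fun k => blockSum π (k + 1) (W α) (W β)
      fun l => Z (subdivide π.pt (k + 1) l)) atTop (covSum π M (W β)) := by
  have hWm : ∀ α t, AEStronglyMeasurable (W α t) P := fun α t =>
    ((hW.adapted α t).mono (𝓕.le t)).aestronglyMeasurable
  have hZm : ∀ t, AEStronglyMeasurable (Z t) P := fun t =>
    ((hZa t).mono (𝓕.le t)).aestronglyMeasurable
  refine tendstoInMeasure_sum _ fun i _ => ?_
  refine tendstoInMeasure_mul_right (fun k => ?_) ?_ (hM.tendsto_increment π i)
  · exact Finset.aestronglyMeasurable_fun_sum _ fun _ _ => (hZm _).mul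
      (Complex.continuous_ofReal.comp_aestronglyMeasurable ((hWm α _).sub (hWm α _)))
  · exact Complex.continuous_ofReal.comp_aestronglyMeasurable ((hWm β _).sub (hWm β _))

/-- Write the integrand inside a step as its value at the left end plus the deviation from it. The
frozen part telescopes to `Z ΔW_α ΔW_β`, which splits into the compensated product and, for `α = β`,
the Riemann summand `Z Δt`. -/
lemma blockSum_eq [DecidableEq ι] (W : ι → ℝ≥0 → Ω → ℝ) (α β : ι) (Z : ℝ≥0 → Ω → ℂ) {t : ℝ≥0}
    (π : Partition t) {K : ℕ} (hK : 0 < K) (ω : Ω) :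
    blockSum π K (W α) (W β) (fun l => Z (subdivide π.pt K l)) ω =
      blockSum π K (W α) (W β) (fun l ω => Z (subdivide π.pt K l) ω - Z (π.pt (l / K)) ω) ω +
      ((∑ i ∈ Finset.range π.size, Z (π.pt i) ω *
        (compensatedProduct W α β (π.pt i) (π.pt (i + 1)) ω : ℂ)) +
      if α = β then
        ∑ i ∈ Finset.range π.size, Z (π.pt i) ω * ((π.pt (i + 1) - π.pt i : ℝ) : ℂ) else 0) := by
  have hif : (if α = β then
        ∑ i ∈ Finset.range π.size, Z (π.pt i) ω * ((π.pt (i + 1) - π.pt i : ℝ) : ℂ) else 0) =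
      ∑ i ∈ Finset.range π.size, Z (π.pt i) ω *
        ((if α = β then (π.pt (i + 1) : ℝ) - π.pt i else 0 : ℝ) : ℂ) := by
    split_ifs <;> simp
  rw [hif, ← Finset.sum_add_distrib]
  simp only [blockSum]
  rw [← Finset.sum_add_distrib]
  refine Finset.sum_congr rfl fun i _ => ?_
  have htel : ∑ j ∈ Finset.range K, (W α (subdivide π.pt K (K * i + j + 1)) ω -
      W α (subdivide π.pt K (K * i + j)) ω) = W α (π.pt (i + 1)) ω - W α (π.pt i) ω := by
    have := Finset.sum_range_sub (fun j => W α (subdivide π.pt K (K * i + j)) ω) K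
    simp only [← add_assoc, add_zero] at this
    rw [this, subdivide_mul hK, ← Nat.mul_succ, subdivide_mul hK]
  have hsplit : ∑ j ∈ Finset.range K, (Z (subdivide π.pt K (K * i + j)) ω -
        Z (π.pt ((K * i + j) / K)) ω) * ((W α (subdivide π.pt K (K * i + j + 1)) ω -
          W α (subdivide π.pt K (K * i + j)) ω : ℝ) : ℂ) =
      (∑ j ∈ Finset.range K, Z (subdivide π.pt K (K * i + j)) ω *
        ((W α (subdivide π.pt K (K * i + j + 1)) ω -
          W α (subdivide π.pt K (K * i + j)) ω : ℝ) : ℂ)) -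
      Z (π.pt i) ω * ((W α (π.pt (i + 1)) ω - W α (π.pt i) ω : ℝ) : ℂ) := by
    rw [← htel, Complex.ofReal_sum, Finset.mul_sum, ← Finset.sum_sub_distrib]
    refine Finset.sum_congr rfl fun j hj => ?_
    rw [Nat.mul_add_div hK, Nat.div_eq_of_lt (Finset.mem_range.mp hj), add_zero, sub_mul]
  rw [hsplit, compensatedProduct]
  push_cast
  ring

/-- The covariation of an Itô integral against `W_α` with `W_β`. -/
lemma IsItoIntegral.tendsto_covSum_brownian [IsProbabilityMeasure P] [DecidableEq ι]
    (hW : IsBrownianFamily P 𝓕 W) {α : ι} (β : ι)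
    {Z M : ℝ≥0 → Ω → ℂ} (hZa : StronglyAdapted 𝓕 Z)
    (hZc : ∀ᵐ ω ∂P, Continuous fun t => Z t ω) (hM : IsItoIntegral P Z (W α) M) {t : ℝ≥0}
    {π : ℕ → Partition t} (hπ : Tendsto (fun m => (π m).mesh) atTop (𝓝 0)) :
    TendstoInMeasure P (fun m => covSum (π m) M (W β)) atTop
      (fun ω => if α = β then ∫ s in (0 : ℝ)..t, Z s.toNNReal ω else 0) := by
  have hZm : ∀ t, AEStronglyMeasurable (Z t) P := fun t =>
    ((hZa t).mono (𝓕.le t)).aestronglyMeasurable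
  -- The fineness of the subdivision depends on `m`; the estimates for block sums hold for any
  -- choice of fineness.
  obtain ⟨k, hk⟩ := exists_diagonal_tendstoInMeasure fun m => hM.tendsto_blockSum hW β hZa (π m)
  have h1 := tendstoInMeasure_blockSum hW α β hZa hZc hπ (K := fun m => k m + 1)
    fun m => (k m).succ_pos
  have h2 := tendstoInMeasure_sum_mul_increment hZa hZc hπ
    (fun m => hW.isIncrementArray_compensatedProduct α β (π m).mono)
    (add_nonneg zero_le_one gaussianSqVariance_nonneg)
    (fun m i => hW.integral_compensatedProduct_sq_le α β ((π m).mono (Nat.le_succ i)))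
  have h3 : TendstoInMeasure P (fun m ω => if α = β then
      ∑ i ∈ Finset.range (π m).size, Z ((π m).pt i) ω *
        (((π m).pt (i + 1) - (π m).pt i : ℝ) : ℂ) else 0) atTop
      (fun ω => if α = β then ∫ s in (0 : ℝ)..t, Z s.toNNReal ω else 0) := by
    split_ifs
    · refine tendstoInMeasure_of_tendsto_ae (fun m => ?_) ?_
      · exact Finset.aestronglyMeasurable_fun_sum _ fun _ _ =>
          (hZm _).mul aestronglyMeasurable_const
      · filter_upwards [hZc] with ω hω using tendsto_sum_mul_sub hω hπ
    · exact tendstoInMeasure_const _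
  have h4 := tendstoInMeasure_add hk
    (tendstoInMeasure_add h1 (tendstoInMeasure_add h2 h3))
  simp only [zero_add] at h4
  refine h4.congr_left fun m => Eventually.of_forall fun ω => ?_
  rw [← blockSum_eq W α β Z (π m) (k m).succ_pos ω]
  ring

end Covariation

/-! ### Covariations for the observation record with drift. -/

section Record

variable {Ω : Type*} {mΩ : MeasurableSpace Ω} {P : Measure Ω} {𝓕 : Filtration ℝ≥0 mΩ}

lemma stronglyMeasurable_integral_of_isStronglyProgressive {h : ℝ≥0 → Ω → ℝ}
    (hh : IsStronglyProgressive 𝓕 h) (t : ℝ≥0) :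
    StronglyMeasurable (fun ω => ∫ s in (0 : ℝ)..t, h s.toNNReal ω) := by
  have h1 : StronglyMeasurable fun q : Set.Iic t × Ω => h q.1 q.2 :=
    (hh t).mono (sup_le_sup le_rfl (MeasurableSpace.comap_mono (𝓕.le t)))
  -- Progressive measurability speaks of times in `[0, t]` only; truncating time at `t` gives a
  -- jointly measurable function on all of `ℝ` that agrees on the domain of integration.
  have h2 : Measurable fun q : Ω × ℝ =>
      ((⟨min q.2.toNNReal t, Set.mem_Iic.mpr (min_le_right _ _)⟩ : Set.Iic t), q.1) :=
    Measurable.prodMk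
      (Measurable.subtype_mk ((measurable_snd.real_toNNReal).min measurable_const))
      measurable_fst
  have h3 := (h1.comp_measurable h2).integral_prod_right' (ν := volume.restrict (Set.Ioc 0 (t : ℝ)))
  convert h3 using 2 with ω
  rw [intervalIntegral.integral_of_le t.coe_nonneg]
  refine setIntegral_congr_fun measurableSet_Ioc fun s hs => ?_
  simp only [Function.comp_apply]
  rw [min_eq_left (Real.toNNReal_le_iff_le_coe.mpr hs.2)]

variable {ι : Type*} {Y : ι → ℝ≥0 → Ω → ℝ}

lemma IsObservationRecord.aestronglyMeasurable (hY : IsObservationRecord P 𝓕 Y) (α : ι)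
    (t : ℝ≥0) : AEStronglyMeasurable (Y α t) P := by
  obtain ⟨W, h, hW, hprog, -, hYe⟩ := hY
  refine ((((hW.adapted α t).mono (𝓕.le t)).add
    (stronglyMeasurable_integral_of_isStronglyProgressive (hprog α) t)).aestronglyMeasurable).congr
    ?_
  filter_upwards [hYe α] with ω hω using (hω t).symm

lemma IsObservationRecord.continuous (hY : IsObservationRecord P 𝓕 Y) (α : ι) :
    ∀ᵐ ω ∂P, Continuous fun t => Y α t ω := by
  obtain ⟨W, h, hW, -, hint, hYe⟩ := hY
  filter_upwards [(hW.brownian α).cont, hint α, hYe α] with ω h1 h2 h3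
  simp only [h3]
  exact h1.add (continuous_integral_of_intervalIntegrable h2)

/-- The covariation of an Itô integral against one output quadrature with another one. -/
lemma IsItoIntegral.tendsto_covSum [IsProbabilityMeasure P] [DecidableEq ι]
    (hY : IsObservationRecord P 𝓕 Y) {α : ι} (β : ι)
    {Z J : ℝ≥0 → Ω → ℂ} (hZa : StronglyAdapted 𝓕 Z)
    (hZc : ∀ᵐ ω ∂P, Continuous fun t => Z t ω) (hJ : IsItoIntegral P Z (Y α) J) {t : ℝ≥0}
    {π : ℕ → Partition t} (hπ : Tendsto (fun m => (π m).mesh) atTop (𝓝 0)) :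
    TendstoInMeasure P (fun m => covSum (π m) J (Y β)) atTop
      (fun ω => if α = β then ∫ s in (0 : ℝ)..t, Z s.toNNReal ω else 0) := by
  have hYm := hY.aestronglyMeasurable
  have hYc := hY.continuous
  obtain ⟨W, h, hW, hprog, hint, hYe⟩ := hY
  let V : ι → ℝ≥0 → Ω → ℝ := fun α t ω => ∫ s in (0 : ℝ)..t, h α s.toNNReal ω
  have hVm : ∀ α t, AEStronglyMeasurable (V α t) P := fun α t =>
    (stronglyMeasurable_integral_of_isStronglyProgressive (hprog α) t).aestronglyMeasurable
  have hWm : ∀ α t, AEStronglyMeasurable (W α t) P := fun α t =>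
    ((hW.adapted α t).mono (𝓕.le t)).aestronglyMeasurable
  have hZm : ∀ t, AEStronglyMeasurable (Z t) P := fun t =>
    ((hZa t).mono (𝓕.le t)).aestronglyMeasurable
  let A : ℝ≥0 → Ω → ℂ := fun t ω => ∫ s in (0 : ℝ)..t, Z s.toNNReal ω * (h α s.toNNReal ω : ℂ)
  have hAint : ∀ᵐ ω ∂P, ∀ t : ℝ≥0, IntervalIntegrable
      (fun s : ℝ => Z s.toNNReal ω * (h α s.toNNReal ω : ℂ)) volume 0 t := by
    filter_upwards [hZc, hint α] with ω h1 h2 t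
    exact IntervalIntegrable.continuousOn_mul (f := fun s : ℝ => (h α s.toNNReal ω : ℂ))
      ⟨(h2 t).1.ofReal, (h2 t).2.ofReal⟩
      (h1.comp continuous_real_toNNReal).continuousOn
  -- Removing the drift part `A` turns the integral against `Y α` into one against the Brownian
  -- motion `W α`.
  let M : ℝ≥0 → Ω → ℂ := fun t ω => J t ω - A t ω
  have hM : IsItoIntegral P Z (W α) M := by
    refine ⟨?_, fun t π hπ => ?_⟩
    · filter_upwards [hJ.continuous, hAint] with ω h1 h2
      exact h1.sub (continuous_integral_of_intervalIntegrable h2)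
    · have hA : TendstoInMeasure P (fun m ω => ∑ i ∈ Finset.range (π m).size,
          Z ((π m).pt i) ω * ((V α ((π m).pt (i + 1)) ω - V α ((π m).pt i) ω : ℝ) : ℂ))
          atTop (A t) := by
        refine tendstoInMeasure_of_tendsto_ae (fun m => ?_) ?_
        · exact Finset.aestronglyMeasurable_fun_sum _ fun _ _ => (hZm _).mul
            (Complex.continuous_ofReal.comp_aestronglyMeasurable ((hVm α _).sub (hVm α _)))
        · filter_upwards [hZc, hint α] with ω h1 h2
          exact tendsto_sum_mul_integral h1 h2 hπ
      refine (tendstoInMeasure_sub (hJ.tendsto t π hπ) hA).congr_left fun m => ?_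
      filter_upwards [hYe α] with ω hω
      rw [← Finset.sum_sub_distrib]
      refine Finset.sum_congr rfl fun i _ => ?_
      simp only [hω, V]
      push_cast
      ring
  have hJm := hJ.aestronglyMeasurable hZm (hYm α)
  have hMm := hM.aestronglyMeasurable hZm (hWm α)
  have hAm : ∀ t, AEStronglyMeasurable (A t) P := fun t =>
    ((hJm t).sub (hMm t)).congr (Eventually.of_forall fun ω => sub_sub_cancel _ _)
  -- With `J = M + A` and `Y β = W β + V β`, the covariation sum splits into `[M, W β]`, `[A, Y β]`
  -- and `[M, V β]`; the last two vanish, having one factor of bounded variation and the other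
  -- continuous.
  have h1 := hM.tendsto_covSum_brownian hW β hZa hZc hπ
  have h2 := tendstoInMeasure_covSum_of_boundedVariation_left hAm (hYm β)
    (hAint.mono fun ω hω => HasBoundedIncrementSums.integral hω) (hYc β) hπ
  have h3 := tendstoInMeasure_covSum_of_boundedVariation_right hMm (hVm β) hM.continuous
    ((hint β).mono fun ω hω => HasBoundedIncrementSums.integral hω) hπ
  have h4 := tendstoInMeasure_add h1 (tendstoInMeasure_add h2 h3)
  simp only [add_zero] at h4
  refine h4.congr_left fun m => ?_
  filter_upwards [hYe β] with ω hω
  simp only [covSum, ← Finset.sum_add_distrib]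
  refine Finset.sum_congr rfl fun i _ => ?_
  simp only [hω, V, M]
  push_cast
  ring

/-- The covariation of a semimartingale driven by the record with one of the quadratures. -/
lemma isCovariation_of_eq_add_sum [IsProbabilityMeasure P] [Fintype ι] [DecidableEq ι]
    (hY : IsObservationRecord P 𝓕 Y) {X B : ℝ≥0 → Ω → ℂ} {Z J : ι → ℝ≥0 → Ω → ℂ}
    (hXa : StronglyAdapted 𝓕 X)
    (hB : ∀ᵐ ω ∂P, HasBoundedIncrementSums fun t => B t ω)
    (hZa : ∀ α, StronglyAdapted 𝓕 (Z α)) (hZc : ∀ α, ∀ᵐ ω ∂P, Continuous fun t => Z α t ω)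
    (hJ : ∀ α, IsItoIntegral P (Z α) (Y α) (J α))
    (hX : ∀ᵐ ω ∂P, ∀ t, X t ω = X 0 ω + B t ω + ∑ α, J α t ω) (β : ι) :
    IsCovariation P X (Y β) (fun t ω => ∫ s in (0 : ℝ)..t, Z β s.toNNReal ω) := by
  have hcint : ∀ᵐ ω ∂P, ∀ t : ℝ≥0,
      IntervalIntegrable (fun s : ℝ => Z β s.toNNReal ω) volume 0 t := by
    filter_upwards [hZc β] with ω hω t
    exact (hω.comp continuous_real_toNNReal).intervalIntegrable _ _
  refine ⟨?_, ?_, fun t π hπ => ?_⟩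
  · filter_upwards [hcint] with ω hω using continuous_integral_of_intervalIntegrable hω
  · filter_upwards [hcint] with ω hω
    exact (HasBoundedIncrementSums.integral hω).locallyBoundedVariationOn
  have hXm : ∀ t, AEStronglyMeasurable (X t) P := fun t =>
    ((hXa t).mono (𝓕.le t)).aestronglyMeasurable
  have hYm := hY.aestronglyMeasurable
  have hJm : ∀ α t, AEStronglyMeasurable (J α t) P := fun α =>
    (hJ α).aestronglyMeasurable (fun t => ((hZa α t).mono (𝓕.le t)).aestronglyMeasurable) (hYm α)
  -- Measurability of `B` is read off from the equation, where all other terms are measurable.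
  have hBm : ∀ t, AEStronglyMeasurable (B t) P := fun t => by
    refine (((hXm t).sub (hXm 0)).sub
      (Finset.aestronglyMeasurable_fun_sum Finset.univ fun α _ => hJm α t)).congr ?_
    filter_upwards [hX] with ω hω
    simp only [Pi.sub_apply]
    rw [hω t]
    ring
  have h1 := tendstoInMeasure_covSum_of_boundedVariation_left hBm (hYm β) hB (hY.continuous β) hπ
  have h2 := tendstoInMeasure_sum Finset.univ fun α _ =>
    (hJ α).tendsto_covSum hY β (hZa α) (hZc α) hπ
  have h3 := tendstoInMeasure_add h1 h2
  simp only [zero_add, Finset.sum_ite_eq', Finset.mem_univ, if_true] at h3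
  refine h3.congr_left fun m => ?_
  filter_upwards [hX] with ω hω
  simp only [covSum]
  rw [Finset.sum_comm, ← Finset.sum_add_distrib]
  refine Finset.sum_congr rfl fun i _ => ?_
  rw [hω ((π m).pt (i + 1)), hω ((π m).pt i), ← Finset.sum_mul, ← add_mul,
    Finset.sum_sub_distrib]
  ring

/-- Limits in probability are unique at each time; continuity passes from a countable dense set of
times to all times off one null set. -/
lemma IsCovariation.ae_eq {X C C' : ℝ≥0 → Ω → ℂ} {Y : ℝ≥0 → Ω → ℝ} (hC : IsCovariation P X Y C)
    (hC' : IsCovariation P X Y C') : ∀ᵐ ω ∂P, ∀ t, C t ω = C' t ω := by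
  have h : ∀ t, C t =ᵐ[P] C' t := fun t => by
    obtain ⟨π, hπ⟩ := exists_partition_tendsto_mesh t
    exact tendstoInMeasure_ae_unique (hC.tendsto t π hπ) (hC'.tendsto t π hπ)
  obtain ⟨S, hS, hSd⟩ := TopologicalSpace.exists_countable_dense ℝ≥0
  have hall : ∀ᵐ ω ∂P, ∀ t ∈ S, C t ω = C' t ω := (ae_ball_iff hS).mpr fun t _ => h t
  filter_upwards [hall, hC.continuous, hC'.continuous] with ω h1 h2 h3 t
  exact congrFun (Continuous.ext_on hSd h2 h3 h1) t

end Record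

/-! ### Algebra of the super-operators. -/

section Algebra

variable {𝔥 : Type*} [NormedAddCommGroup 𝔥] [InnerProductSpace ℂ 𝔥] [CompleteSpace 𝔥]

lemma zeta_apply (B X : 𝔥 →L[ℂ] 𝔥) : zeta B X = X * B + star B * X := rfl

lemma dissipator_apply (L X : 𝔥 →L[ℂ] 𝔥) : dissipator L X = star L * X * L -
    (1 / 2 : ℂ) • (star L * L * X) - (1 / 2 : ℂ) • (X * (star L * L)) := rfl

lemma zeta_add (B C : 𝔥 →L[ℂ] 𝔥) : zeta (B + C) = zeta B + zeta C := by
  ext1 X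
  simp only [LinearMap.add_apply, zeta_apply, star_add, mul_add, add_mul]
  abel

lemma zeta_sum {κ : Type*} (s : Finset κ) (B : κ → 𝔥 →L[ℂ] 𝔥) :
    zeta (∑ a ∈ s, B a) = ∑ a ∈ s, zeta (B a) := by
  classical
  induction s using Finset.induction_on with
  | empty => ext1 X; simp [zeta_apply]
  | insert a s ha ih => rw [Finset.sum_insert ha, Finset.sum_insert ha, zeta_add, ih]

/-- The adjoint of `-iH` is `iH`, so the two terms of `ζ` form the commutator. -/
lemma zeta_neg_I_smul {H : 𝔥 →L[ℂ] 𝔥} (hH : IsSelfAdjoint H) :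
    zeta (-(Complex.I • H)) = hamiltonianPart H := by
  ext1 X
  change X * -(Complex.I • H) + star (-(Complex.I • H)) * X = -(Complex.I • (X * H - H * X))
  rw [star_neg, star_smul, hH.star_eq]
  simp [smul_sub, neg_add_eq_sub]

lemma star_exp_I_mul (x : ℝ) :
    star (Complex.exp (Complex.I * x)) = Complex.exp (-(Complex.I * x)) := by
  rw [Complex.star_def, ← Complex.exp_conj]
  simp

/-- The contribution of one measured channel to the Stratonovich generator. -/
lemma dissipator_sub_zeta_zeta (L : 𝔥 →L[ℂ] 𝔥) {u v : ℂ} (hv : star u = v) (huv : u * v = 1) :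
    dissipator L - (1 / 2 : ℂ) • (zeta (u • L) ∘ₗ zeta (u • L)) =
      zeta (-((1 / 2 : ℂ) • (star L * L + (u * u) • (L * L)))) := by
  ext1 X
  -- Expanding, `ζ ∘ ζ` sends `X` to `u² X L² + 2uv L* X L + v² L*² X`. As `uv = 1`, half of it
  -- cancels the sandwich term, and what is left has the form `X K + K* X`.
  simp only [LinearMap.sub_apply, LinearMap.smul_apply, LinearMap.comp_apply, zeta_apply,
    dissipator_apply, star_neg, star_smul, star_add, star_mul, star_star, hv, mul_add, add_mul,
    smul_add, mul_smul_comm, smul_mul_assoc, smul_smul, neg_mul, mul_neg, mul_assoc, huv,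
    one_smul]
  have h2 : star (1 / 2 : ℂ) = 1 / 2 := by simp
  rw [h2]
  module

theorem stratonovichGenerator_eq {n : ℕ} (L : Fin n → 𝔥 →L[ℂ] 𝔥) {H : 𝔥 →L[ℂ] 𝔥}
    (hH : IsSelfAdjoint H) (A : Finset (Fin n)) (θ : A → ℝ) :
    stratonovichGenerator L H θ = zeta (coherentOperator L H θ) + unobservedLindbladian L A := by
  have hK : coherentOperator L H θ = (∑ α : A, -((1 / 2 : ℂ) • (star (L α) * L α +
      (Complex.exp (Complex.I * θ α) * Complex.exp (Complex.I * θ α)) • (L α * L α)))) +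
      -(Complex.I • H) := by
    rw [coherentOperator, Finset.smul_sum, Finset.sum_neg_distrib, sub_eq_add_neg]
    refine congrArg (fun T => -T + -(Complex.I • H)) (Finset.sum_congr rfl fun α _ => ?_)
    rw [← Complex.exp_add]
    congr 4
    ring
  have hsum : ∑ k, dissipator (L k) =
      ∑ α : A, dissipator (L α) + ∑ k ∈ Aᶜ, dissipator (L k) := by
    rw [Finset.sum_coe_sort A fun k => dissipator (L k), Finset.sum_add_sum_compl]
  have hα : ∀ α : A, zeta (-((1 / 2 : ℂ) • (star (L α) * L α +
      (Complex.exp (Complex.I * θ α) * Complex.exp (Complex.I * θ α)) • (L α * L α)))) =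
      dissipator (L α) - (1 / 2 : ℂ) • (zeta (rotated L θ α) ∘ₗ zeta (rotated L θ α)) :=
    fun α => (dissipator_sub_zeta_zeta (L α) (star_exp_I_mul (θ α))
      (by rw [← Complex.exp_add, add_neg_cancel, Complex.exp_zero])).symm
  rw [hK, zeta_add, zeta_sum, zeta_neg_I_smul hH, Finset.sum_congr rfl fun α _ => hα α,
    Finset.sum_sub_distrib, ← Finset.smul_sum, stratonovichGenerator, lindbladian, hsum,
    unobservedLindbladian]
  abel

lemma rotated_zeta_apply {n : ℕ} (L : Fin n → 𝔥 →L[ℂ] 𝔥) {A : Finset (Fin n)} (θ : A → ℝ)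
    (α : A) (X : 𝔥 →L[ℂ] 𝔥) : zeta (rotated L θ α) X = Complex.exp (Complex.I * θ α) • (X * L α) +
      Complex.exp (-(Complex.I * θ α)) • (star (L α) * X) := by
  rw [zeta_apply, rotated, star_smul, star_exp_I_mul, mul_smul_comm, smul_mul_assoc]

lemma lindbladian_apply_eq {n : ℕ} (L : Fin n → 𝔥 →L[ℂ] 𝔥) (H : 𝔥 →L[ℂ] 𝔥)
    {A : Finset (Fin n)} (θ : A → ℝ) (X : 𝔥 →L[ℂ] 𝔥) :
    lindbladian L H X = stratonovichGenerator L H θ X +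
      (1 / 2 : ℂ) • ∑ α, zeta (rotated L θ α) (zeta (rotated L θ α) X) := by
  simp [stratonovichGenerator]

end Algebra

/-! ### Equivalence of the Itô and Stratonovich equations. -/

section Equivalence

variable {Ω : Type*} {mΩ : MeasurableSpace Ω} {P : Measure Ω} {𝓕 : Filtration ℝ≥0 mΩ}
  {𝔥 : Type*} [NormedAddCommGroup 𝔥] [InnerProductSpace ℂ 𝔥] [CompleteSpace 𝔥] {n : ℕ}
  {L : Fin n → 𝔥 →L[ℂ] 𝔥} {H : 𝔥 →L[ℂ] 𝔥} {A : Finset (Fin n)} {θ : A → ℝ}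
  {Y : A → ℝ≥0 → Ω → ℝ} {ρ₀ : 𝔥 →L[ℂ] 𝔥} {σ : ℝ≥0 → Ω → (𝔥 →L[ℂ] 𝔥) →ₗ[ℂ] ℂ}

lemma IsFunctionalProcess.intervalIntegrable (hσ : IsFunctionalProcess P 𝓕 ρ₀ σ)
    (X : 𝔥 →L[ℂ] 𝔥) : ∀ᵐ ω ∂P, ∀ t : ℝ≥0,
      IntervalIntegrable (fun s : ℝ => σ s.toNNReal ω X) volume 0 t := by
  filter_upwards [hσ.continuous X] with ω hω t
  exact (hω.comp continuous_real_toNNReal).intervalIntegrable _ _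

lemma IsFunctionalProcess.integral_lindbladian (hσ : IsFunctionalProcess P 𝓕 ρ₀ σ)
    (L : Fin n → 𝔥 →L[ℂ] 𝔥) (H : 𝔥 →L[ℂ] 𝔥) (θ : A → ℝ) (X : 𝔥 →L[ℂ] 𝔥) :
    ∀ᵐ ω ∂P, ∀ t : ℝ≥0, ∫ s in (0 : ℝ)..t, σ s.toNNReal ω (lindbladian L H X) =
      (∫ s in (0 : ℝ)..t, σ s.toNNReal ω (stratonovichGenerator L H θ X)) +
      ∑ α, (1 / 2 : ℂ) * ∫ s in (0 : ℝ)..t,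
        σ s.toNNReal ω (zeta (rotated L θ α) (zeta (rotated L θ α) X)) := by
  have hall := ae_all_iff.mpr fun α : A =>
    hσ.intervalIntegrable (zeta (rotated L θ α) (zeta (rotated L θ α) X))
  filter_upwards [hall, hσ.intervalIntegrable (stratonovichGenerator L H θ X)] with ω h1 h2 t
  simp only [lindbladian_apply_eq L H θ X, map_add, map_smul, map_sum, smul_eq_mul,
    Finset.mul_sum]
  have h3 : IntervalIntegrable (fun s : ℝ => ∑ α : A, (1 / 2 : ℂ) *
      σ s.toNNReal ω (zeta (rotated L θ α) (zeta (rotated L θ α) X))) volume 0 t := by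
    simpa only [Finset.sum_fn] using! IntervalIntegrable.sum Finset.univ
      fun α _ => (h1 α t).const_mul (1 / 2 : ℂ)
  rw [intervalIntegral.integral_add (h2 t) h3,
    intervalIntegral.integral_finsetSum fun α _ => (h1 α t).const_mul _]
  simp only [intervalIntegral.integral_const_mul]

lemma SolvesIto.isCovariation [IsProbabilityMeasure P] (hY : IsObservationRecord P 𝓕 Y)
    (h : SolvesIto P 𝓕 L H θ Y ρ₀ σ) (X : 𝔥 →L[ℂ] 𝔥) (α : A) :
    IsCovariation P (fun t ω => σ t ω X) (Y α)
      (fun t ω => ∫ s in (0 : ℝ)..t, σ s.toNNReal ω (zeta (rotated L θ α) X)) := by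
  obtain ⟨J, hJ, hX⟩ := h.equation X
  simp only [← rotated_zeta_apply] at hJ
  exact isCovariation_of_eq_add_sum hY
    (B := fun t ω => ∫ s in (0 : ℝ)..t, σ s.toNNReal ω (lindbladian L H X))
    (h.process.adapted X)
    ((h.process.intervalIntegrable _).mono fun ω hω => HasBoundedIncrementSums.integral hω)
    (fun α => h.process.adapted (zeta (rotated L θ α) X))
    (fun α => h.process.continuous (zeta (rotated L θ α) X)) hJ hX α

/-- There is no circularity: the unknown brackets `C` inside the Stratonovich integrals enter only
through their bounded variation, so `½ C` joins the drift and does not affect the covariation with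
`Y α`. -/
lemma SolvesStratonovich.isCovariation [IsProbabilityMeasure P]
    (hY : IsObservationRecord P 𝓕 Y)
    (h : SolvesStratonovich P 𝓕 L H θ Y ρ₀ σ) (X : 𝔥 →L[ℂ] 𝔥) (α : A) :
    IsCovariation P (fun t ω => σ t ω X) (Y α)
      (fun t ω => ∫ s in (0 : ℝ)..t, σ s.toNNReal ω (zeta (rotated L θ α) X)) := by
  obtain ⟨S, hS, hX⟩ := h.equation X
  choose J C hJ hC hSJC using hS
  refine isCovariation_of_eq_add_sum hY
    (B := fun t ω => (∫ s in (0 : ℝ)..t, σ s.toNNReal ω (stratonovichGenerator L H θ X)) +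
      ∑ α, (1 / 2 : ℂ) * C α t ω)
    (h.process.adapted X) ?_
    (fun α => h.process.adapted (zeta (rotated L θ α) X))
    (fun α => h.process.continuous (zeta (rotated L θ α) X)) hJ ?_ α
  · filter_upwards [h.process.intervalIntegrable (stratonovichGenerator L H θ X),
      ae_all_iff.mpr fun α => (hC α).boundedVariation] with ω h1 h2
    refine (HasBoundedIncrementSums.integral h1).add (HasBoundedIncrementSums.sum _ fun α _ => ?_)
    exact (HasBoundedIncrementSums.of_locallyBoundedVariationOn (h2 α)).const_mul _
  · filter_upwards [hX] with ω hω t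
    rw [hω t]
    simp only [hSJC, Finset.sum_add_distrib]
    ring

theorem solvesIto_iff_solvesStratonovich [IsProbabilityMeasure P]
    (hY : IsObservationRecord P 𝓕 Y) :
    SolvesIto P 𝓕 L H θ Y ρ₀ σ ↔ SolvesStratonovich P 𝓕 L H θ Y ρ₀ σ := by
  refine ⟨fun h => ⟨h.process, fun X => ?_⟩, fun h => ⟨h.process, fun X => ?_⟩⟩
  · obtain ⟨J, hJ, hX⟩ := h.equation X
    simp only [← rotated_zeta_apply] at hJ
    refine ⟨fun α t ω => J α t ω + (1 / 2 : ℂ) * ∫ s in (0 : ℝ)..t,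
      σ s.toNNReal ω (zeta (rotated L θ α) (zeta (rotated L θ α) X)),
      -- The bracket formula is used at `ζ_α X`, which shows both that the bracket exists and that
      -- it is the integral of `σ(ζ_α ζ_α X)`.
      fun α => ⟨J α, _, hJ α, h.isCovariation hY _ α, fun _ _ => rfl⟩, ?_⟩
    filter_upwards [hX, h.process.integral_lindbladian L H θ X] with ω h1 h2 t
    rw [h1 t, h2 t, Finset.sum_add_distrib]
    ring
  · obtain ⟨S, hS, hX⟩ := h.equation X
    choose J C hJ hC hSJC using hS
    refine ⟨J, fun α => by simpa only [← rotated_zeta_apply] using hJ α, ?_⟩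
    -- The given bracket `C α` and the computed one at `ζ_α X` agree for all times almost surely, so
    -- `½ C α` restores the missing part of the Lindbladian drift.
    filter_upwards [hX, h.process.integral_lindbladian L H θ X,
      ae_all_iff.mpr fun α => (hC α).ae_eq (h.isCovariation hY _ α)] with ω h1 h2 h3 t
    rw [h1 t, h2 t]
    simp only [hSJC, h3, Finset.sum_add_distrib]
    ring

end Equivalence

end BelavkinZakai

end

theorem mainTheorem3 {𝔥 : Type*} [NormedAddCommGroup 𝔥] [InnerProductSpace ℂ 𝔥]
    [CompleteSpace 𝔥] {n : ℕ} (L : Fin n → 𝔥 →L[ℂ] 𝔥) (H : 𝔥 →L[ℂ] 𝔥) (hH : IsSelfAdjoint H)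
    (A : Finset (Fin n)) (θ : A → ℝ) :
    (∀ {Ω : Type*} [mΩ : MeasurableSpace Ω] (P : Measure Ω) [IsProbabilityMeasure P]
      (𝓕 : Filtration ℝ≥0 mΩ) (Y : A → ℝ≥0 → Ω → ℝ),
      BelavkinZakai.IsObservationRecord P 𝓕 Y →
      ∀ ρ₀ : 𝔥 →L[ℂ] 𝔥, BelavkinZakai.IsDensityOperator ρ₀ →
      ∀ σ : ℝ≥0 → Ω → (𝔥 →L[ℂ] 𝔥) →ₗ[ℂ] ℂ,
        (BelavkinZakai.SolvesIto P 𝓕 L H θ Y ρ₀ σ ↔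
          BelavkinZakai.SolvesStratonovich P 𝓕 L H θ Y ρ₀ σ)) ∧
    BelavkinZakai.stratonovichGenerator L H θ =
      BelavkinZakai.zeta (BelavkinZakai.coherentOperator L H θ) +
        BelavkinZakai.unobservedLindbladian L A := by
  exact ⟨fun _ _ _ _ hY _ _ _ => BelavkinZakai.solvesIto_iff_solvesStratonovich hY,
    BelavkinZakai.stratonovichGenerator_eq L hH A θ⟩
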